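/- **Setting.** Let $\Omega\subset\mathbb R^2$ be a (bounded, open) convex polygonal domain with boundary $\partial\Omega=\Gamma_D\cup\Gamma_N$, where $\Gamma_D,\Gamma_N$ are measurable, $\mathrm{meas}(\Gamma_D)>0$, and either $\Gamma_N=\emptyset$ or $\mathrm{meas}(\Gamma_N)>0$. Let $V=\{v\in H^1(\Omega)^2: v|_{\Gamma_D}=0\}$, $|v|_1=\|\nabla v\|_{L^2(\Omega)}$, $\varepsilon(v)=\frac12(\nabla v+\nabla v^T)$. Let $L=L^2(\Omega)$ and $\Sigma=L^2(\Omega;\mathbb R^{2\times2}_{sym})$ if $\mathrm{meas}(\Gamma_N)>0$; if $\Gamma_N=\emptyset$ require in addition $\int_\Omega q=0$ for $q\in L$ and $\int_\Omega \mathrm{tr}\,\tau=0$ for $\tau\in\Sigma$. Norms $\|\cdot\|_0$ are $L^2(\Omega)$ norms. For Lamé parameters $\mu,\lambda>0$ put $$a(\sigma,\tau)=\frac1{2\mu}\int_\Omega\Big(\sigma:\tau-\frac{\lambda}{2(\mu+\lambda)}\,\mathrm{tr}\,\sigma\,\mathrm{tr}\,\tau\Big)dx .$$ **Meshes.** A mesh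 $T_h$ is a finite conforming partition of $\overline\Omega$ into closed convex nondegenerate quadrilaterals $K$ with vertices $Z_1,\dots,Z_4$ in counterclockwise order; $h_K=\mathrm{diam}\,K$, $h=\max_K h_K$, and $\rho_K$ is the smallest diameter of the circles inscribed in the four triangles $Z_{i-1}Z_iZ_{i+1}$ (indices mod 4). The bilinear map $F_K:[-1,1]^2\to K$, taking $(-1,-1),(1,-1),(1,1),(-1,1)$ to $Z_1,Z_2,Z_3,Z_4$, is written $$x=a_0+a_1\xi+a_2\eta+a_{12}\xi\eta,\qquad y=b_0+b_1\xi+b_2\eta+b_{12}\xi\eta ,$$ and the vertices are numbered so that $a_1>0$, $b_2>0$. Let $d_K=2\sqrt{a_{12}^2+b_{12}^2}$ be the distance between the midpoints of the diagonals of $K$. **Discrete spaces.** $V_h=\{v\in V: v|_K\circ F_K\in\mathrm{span}\{1,\xi,\eta,\xi\eta\}^2\ \forall K\in T_h\}$. $\bar W_h$ is the space of all $\bar q\in L$ that are constant on each $K\in T_h$. The ECQ4 stress space $\Sigma_h^{EC}$ consists of all $\tau\in\Sigma$ such that for each $K\in T_h$ there is $\beta\in\mathbb R^5$ with $$\begin{pmatrix}\tau_{11}\\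 \tau_{22}\\ \tau_{12}\end{pmatrix}\circ F_K= \begin{pmatrix} 1-\frac{b_{12}}{b_2}\xi & \frac{a_{12}a_2}{b_2^2}\xi & \frac{a_{12}b_2-a_2b_{12}}{b_2^2}\xi & \eta & \frac{a_2^2}{b_2^2}\xi\\ \frac{b_1b_{12}}{a_1^2}\eta & 1-\frac{a_{12}}{a_1}\eta & \frac{a_1b_{12}-a_{12}b_1}{a_1^2}\eta & \frac{b_1^2}{a_1^2}\eta & \xi\\ \frac{b_{12}}{a_1}\eta & \frac{a_{12}}{b_2}\xi & 1-\frac{b_{12}}{b_2}\xi-\frac{a_{12}}{a_1}\eta & \frac{b_1}{a_1}\eta & \frac{a_2}{b_2}\xi \end{pmatrix}\beta .$$ Put $Z_h=\{\tau\in\Sigma_h^{EC}:\int_\Omega\tau:\varepsilon(v)\,dx=0\ \ \forall v\in V_h\}$. **Theorem 4.4.** Consider a family of such meshes of $\Omega$ satisfying: 1. (shape regularity) there is $\varrho>2$ with $h_K\le\varrho\,\rho_K$ for all elements $K$ of all meshes of the family; 2. (Q1–P0 stability) there is $C_0>0$ such that, for every mesh of the family and every $\bar q\in\bar W_h$, there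 is $v\in V_h$ with $\|\bar q\|_0^2\le C_0\int_\Omega\bar q\,\mathrm{div}\,v\,dx$ and $|v|_1^2\le C_0\|\bar q\|_0^2$; 3. (Condition (A)) $d_K=o(h_K)$ uniformly for all elements as $h\to0$: for every $\epsilon>0$ there is $\delta>0$ such that $d_K\le\epsilon h_K$ for all elements $K$ of all meshes of the family with $h<\delta$. Then the uniform discrete kernel-coercivity $(\mathrm{A1}_h)$ holds for the ECQ4 stress space when $h$ is sufficiently small: there is $h_0>0$ and, for every $\mu_1>0$, a constant $C>0$ such that for all $0<\mu\le\mu_1$, all $\lambda>0$ and every mesh of the family with $h<h_0$, $$\|\tau\|_0^2\le C\,a(\tau,\tau)\qquad\text{for all }\tau\in Z_h .$$ In particular $h_0$ and $C$ do not depend on $\lambda$, and $C$ does not depend on $h$. -/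

import Mathlib

open MeasureTheory Filter Topology
open scoped ContDiff

noncomputable section

namespace ECQ4

/-- The Euclidean plane. -/
abbrev Plane : Type := EuclideanSpace ℝ (Fin 2)

/-- The point of the plane with coordinates `x`, `y`. -/
def pt (x y : ℝ) : Plane := !₂[x, y]

/-! ### Domains and function spaces -/

/-- Convex polygonal domains: the nonempty interiors of convex hulls of finite sets. -/
def IsConvexPolygonalDomain (Ω : Set Plane) : Prop :=
  Ω.Nonempty ∧ ∃ s : Finset Plane, Ω = interior (convexHull ℝ (s : Set Plane))

/-- `g` is the weak gradient of the scalar function `u` on `Ω`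
(`g · j` is the weak partial derivative with respect to the `j`-th coordinate). -/
def IsWeakGradient (Ω : Set Plane) (u : Plane → ℝ) (g : Plane → Fin 2 → ℝ) : Prop :=
  ∀ (j : Fin 2) (φ : Plane → ℝ), ContDiff ℝ ∞ φ → HasCompactSupport φ → tsupport φ ⊆ Ω →
    ∫ x in Ω, u x * fderiv ℝ φ x (EuclideanSpace.single j 1) = - ∫ x in Ω, g x j * φ x

/-- `u ∈ H¹(Ω)` with weak gradient `g`. -/
structure MemH1 (Ω : Set Plane) (u : Plane → ℝ) (g : Plane → Fin 2 → ℝ) : Prop where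
  memLp : MemLp u 2 (volume.restrict Ω)
  memLp_grad : ∀ j, MemLp (fun x => g x j) 2 (volume.restrict Ω)
  weak : IsWeakGradient Ω u g

/-- `u ∈ H¹(Ω)` with weak gradient `g` and trace `u|_{ΓD} = 0`. The trace operator is the continuous
extension to `H¹(Ω)` of the restriction of smooth functions to the boundary, so that the
trace vanishes on `ΓD` when `u` is the `H¹`-limit of functions smooth up to the boundary whose
restrictions to `ΓD` tend to zero in `L²(ΓD)` with respect to arc length. -/
structure MemH1D (Ω ΓD : Set Plane) (u : Plane → ℝ) (g : Plane → Fin 2 → ℝ) : Prop where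
  memH1 : MemH1 Ω u g
  trace_eq_zero : ∃ φ : ℕ → Plane → ℝ, (∀ n, ContDiff ℝ ∞ (φ n)) ∧
    Tendsto (fun n => eLpNorm (fun x => φ n x - u x) 2 (volume.restrict Ω)) atTop (𝓝 0) ∧
    (∀ j, Tendsto (fun n => eLpNorm
      (fun x => fderiv ℝ (φ n) x (EuclideanSpace.single j 1) - g x j) 2 (volume.restrict Ω))
      atTop (𝓝 0)) ∧
    Tendsto (fun n => eLpNorm (φ n) 2 ((Measure.hausdorffMeasure 1).restrict ΓD)) atTop (𝓝 0)

/-- `v` belongs to `V = H¹_D(Ω)²` and `Dv` is its weak Jacobian, `Dv · i j = ∂ⱼ vᵢ`. -/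
def MemV (Ω ΓD : Set Plane) (v : Plane → Fin 2 → ℝ)
    (Dv : Plane → Matrix (Fin 2) (Fin 2) ℝ) : Prop :=
  ∀ i, MemH1D Ω ΓD (fun x => v x i) (fun x => Dv x i)

/-- The contraction `A : B = ∑ᵢⱼ Aᵢⱼ Bᵢⱼ`. -/
def contract (A B : Matrix (Fin 2) (Fin 2) ℝ) : ℝ := ∑ i, ∑ j, A i j * B i j

/-- The strain `ε(v)` in terms of the Jacobian of `v`. -/
def strain (D : Matrix (Fin 2) (Fin 2) ℝ) : Matrix (Fin 2) (Fin 2) ℝ :=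
  (1 / 2 : ℝ) • (D + D.transpose)

/-- Square-integrable scalar functions on `Ω`, with mean value zero when `ΓN = ∅`. -/
structure MemL (Ω ΓN : Set Plane) (q : Plane → ℝ) : Prop where
  memLp : MemLp q 2 (volume.restrict Ω)
  mean_zero : ΓN = ∅ → ∫ x in Ω, q x = 0

/-- The stress space `Σ`: square-integrable symmetric tensor fields on `Ω`, whose trace has mean
value zero when `ΓN = ∅`. -/
structure MemSigma (Ω ΓN : Set Plane) (τ : Plane → Matrix (Fin 2) (Fin 2) ℝ) : Prop where
  symm : ∀ x ∈ Ω, (τ x).IsSymm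
  memLp : ∀ i j, MemLp (fun x => τ x i j) 2 (volume.restrict Ω)
  mean_zero : ΓN = ∅ → ∫ x in Ω, (τ x).trace = 0

/-- The squared `L²(Ω)` norm of a tensor field. For a Jacobian `Dv` this is `|v|₁²`. -/
def normSq (Ω : Set Plane) (τ : Plane → Matrix (Fin 2) (Fin 2) ℝ) : ℝ :=
  ∫ x in Ω, contract (τ x) (τ x)

/-- The compliance tensor, inverse of `ε ↦ 2 μ ε + lam (tr ε) I`. -/
def compliance (μ lam : ℝ) (τ : Matrix (Fin 2) (Fin 2) ℝ) : Matrix (Fin 2) (Fin 2) ℝ :=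
  (1 / (2 * μ)) • (τ - (lam / (2 * (μ + lam)) * τ.trace) • (1 : Matrix (Fin 2) (Fin 2) ℝ))

/-- The bilinear form `a(σ, τ) = ∫_Ω σ : ℂ⁻¹ τ`. -/
def aForm (Ω : Set Plane) (μ lam : ℝ) (σ τ : Plane → Matrix (Fin 2) (Fin 2) ℝ) : ℝ :=
  ∫ x in Ω, contract (σ x) (compliance μ lam (τ x))

/-! ### Quadrilaterals -/

/-- Twice the signed area of the triangle `A B C`. -/
def cross (A B C : Plane) : ℝ :=
  (B 0 - A 0) * (C 1 - A 1) - (B 1 - A 1) * (C 0 - A 0)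

/-- A nondegenerate convex quadrilateral with vertices `z 0, z 1, z 2, z 3` in counterclockwise
order. The numbering starts at the vertex for which the coefficients `a₁` and `b₂` of the
isoparametric map below are positive; every such quadrilateral has such a numbering. -/
structure Quad where
  z : Fin 4 → Plane
  ccw : ∀ i, 0 < cross (z i) (z (i + 1)) (z (i + 2))
  a₁_pos : 0 < (-z 0 0 + z 1 0 + z 2 0 - z 3 0) / 4
  b₂_pos : 0 < (-z 0 1 - z 1 1 + z 2 1 + z 3 1) / 4

namespace Quad

/-- The closed quadrilateral. -/
def carrier (K : Quad) : Set Plane := convexHull ℝ (Set.range K.z)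

/-- The isoparametric bilinear map from the reference square `[-1,1]²` onto the quadrilateral. -/
def F (K : Quad) (ξ η : ℝ) : Plane :=
  ((1 - ξ) * (1 - η) / 4) • K.z 0 + ((1 + ξ) * (1 - η) / 4) • K.z 1 +
    ((1 + ξ) * (1 + η) / 4) • K.z 2 + ((1 - ξ) * (1 + η) / 4) • K.z 3

/-- Coefficient of `ξ` in the first coordinate of `F`. -/
def a₁ (K : Quad) : ℝ := (-K.z 0 0 + K.z 1 0 + K.z 2 0 - K.z 3 0) / 4
/-- Coefficient of `η` in the first coordinate of `F`. -/
def a₂ (K : Quad) : ℝ := (-K.z 0 0 - K.z 1 0 + K.z 2 0 + K.z 3 0) / 4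
/-- Coefficient of `ξ η` in the first coordinate of `F`. -/
def a₁₂ (K : Quad) : ℝ := (K.z 0 0 - K.z 1 0 + K.z 2 0 - K.z 3 0) / 4
/-- Coefficient of `ξ` in the second coordinate of `F`. -/
def b₁ (K : Quad) : ℝ := (-K.z 0 1 + K.z 1 1 + K.z 2 1 - K.z 3 1) / 4
/-- Coefficient of `η` in the second coordinate of `F`. -/
def b₂ (K : Quad) : ℝ := (-K.z 0 1 - K.z 1 1 + K.z 2 1 + K.z 3 1) / 4
/-- Coefficient of `ξ η` in the second coordinate of `F`. -/
def b₁₂ (K : Quad) : ℝ := (K.z 0 1 - K.z 1 1 + K.z 2 1 - K.z 3 1) / 4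

/-- The diameter `h_K`. -/
def diam (K : Quad) : ℝ := Metric.diam K.carrier

/-- The diameter of the largest disc contained in the triangle `A B C`, its inscribed circle. -/
def inscribedDiam (A B C : Plane) : ℝ :=
  sSup {d : ℝ | ∃ (c : Plane) (r : ℝ), 0 ≤ r ∧ d = 2 * r ∧
    Metric.closedBall c r ⊆ convexHull ℝ {A, B, C}}

/-- `ρ_K`: the smallest diameter of the circles inscribed in the four triangles spanned by three
consecutive vertices. -/
def rho (K : Quad) : ℝ := ⨅ i : Fin 4, inscribedDiam (K.z (i - 1)) (K.z i) (K.z (i + 1))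

/-- `d_K`: the distance between the midpoints of the two diagonals. -/
def diagDist (K : Quad) : ℝ := dist (midpoint ℝ (K.z 0) (K.z 2)) (midpoint ℝ (K.z 1) (K.z 3))

/-- The matrix of the five-parameter ECQ4 stress mode; its rows give the components
`11`, `22`, `12` of the stress. -/
def ecMode (K : Quad) (ξ η : ℝ) : Matrix (Fin 3) (Fin 5) ℝ :=
  !![1 - K.b₁₂ / K.b₂ * ξ, K.a₁₂ * K.a₂ / K.b₂ ^ 2 * ξ,
      (K.a₁₂ * K.b₂ - K.a₂ * K.b₁₂) / K.b₂ ^ 2 * ξ, η, K.a₂ ^ 2 / K.b₂ ^ 2 * ξ;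
    K.b₁ * K.b₁₂ / K.a₁ ^ 2 * η, 1 - K.a₁₂ / K.a₁ * η,
      (K.a₁ * K.b₁₂ - K.a₁₂ * K.b₁) / K.a₁ ^ 2 * η, K.b₁ ^ 2 / K.a₁ ^ 2 * η, ξ;
    K.b₁₂ / K.a₁ * η, K.a₁₂ / K.b₂ * ξ,
      1 - K.b₁₂ / K.b₂ * ξ - K.a₁₂ / K.a₁ * η, K.b₁ / K.a₁ * η, K.a₂ / K.b₂ * ξ]

end Quad

/-! ### Meshes -/

/-- Conforming quadrilateral meshes of `Ω`: two distinct elements are disjoint, or share exactly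
a common vertex, or share exactly a common edge. -/
structure QuadMesh (Ω : Set Plane) where
  elems : Finset Quad
  cover : closure Ω = ⋃ K ∈ elems, K.carrier
  conforming : ∀ K ∈ elems, ∀ L ∈ elems, K ≠ L →
    K.carrier ∩ L.carrier = ∅ ∨
    (∃ i j, K.z i = L.z j ∧ K.carrier ∩ L.carrier = {K.z i}) ∨
    (∃ i j, K.z i = L.z (j + 1) ∧ K.z (i + 1) = L.z j ∧
      K.carrier ∩ L.carrier = segment ℝ (K.z i) (K.z (i + 1)))

/-- The mesh size `h = max_K h_K`. -/
def QuadMesh.size {Ω : Set Plane} (T : QuadMesh Ω) : ℝ := ⨆ K : T.elems, (K : Quad).diam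

/-- Shape regularity of a family of meshes. -/
def ShapeRegular {Ω : Set Plane} {ι : Type*} (T : ι → QuadMesh Ω) : Prop :=
  ∃ ϱ : ℝ, 2 < ϱ ∧ ∀ i, ∀ K ∈ (T i).elems, K.diam ≤ ϱ * K.rho

/-- `d_K = o(h_K)` uniformly for all elements of the family as the mesh size tends to zero. -/
def ConditionA {Ω : Set Plane} {ι : Type*} (T : ι → QuadMesh Ω) : Prop :=
  ∀ ε : ℝ, 0 < ε → ∃ δ : ℝ, 0 < δ ∧ ∀ i, (T i).size < δ →
    ∀ K ∈ (T i).elems, K.diagDist ≤ ε * K.diam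

/-! ### Discrete spaces

The conditions on elements are imposed on the open elements: their boundaries are Lebesgue-null, and
a discontinuous piecewise function has several limits there. -/

/-- `v ∈ V_h` (continuous isoparametric bilinear displacements), with Jacobian `Dv`. -/
structure MemVh {Ω : Set Plane} (ΓD : Set Plane) (T : QuadMesh Ω) (v : Plane → Fin 2 → ℝ)
    (Dv : Plane → Matrix (Fin 2) (Fin 2) ℝ) : Prop where
  memV : MemV Ω ΓD v Dv
  bilinear : ∀ K ∈ T.elems, ∃ c : Fin 4 → Fin 2 → ℝ, ∀ ξ ∈ Set.Ioo (-1 : ℝ) 1,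
    ∀ η ∈ Set.Ioo (-1 : ℝ) 1, ∀ i,
      v (K.F ξ η) i = c 0 i + c 1 i * ξ + c 2 i * η + c 3 i * (ξ * η)

/-- Piecewise constant pressures in `L²(Ω)`, with mean value zero when `ΓN = ∅`. -/
structure MemWbar {Ω : Set Plane} (ΓN : Set Plane) (T : QuadMesh Ω) (q : Plane → ℝ) : Prop where
  memL : MemL Ω ΓN q
  const : ∀ K ∈ T.elems, ∃ c : ℝ, ∀ ξ ∈ Set.Ioo (-1 : ℝ) 1, ∀ η ∈ Set.Ioo (-1 : ℝ) 1,
    q (K.F ξ η) = c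

/-- `τ ∈ Σ_h^EC`, the ECQ4 stress space. -/
structure MemSigmaEC {Ω : Set Plane} (ΓN : Set Plane) (T : QuadMesh Ω)
    (τ : Plane → Matrix (Fin 2) (Fin 2) ℝ) : Prop where
  memSigma : MemSigma Ω ΓN τ
  mode : ∀ K ∈ T.elems, ∃ β : Fin 5 → ℝ, ∀ ξ ∈ Set.Ioo (-1 : ℝ) 1, ∀ η ∈ Set.Ioo (-1 : ℝ) 1,
    ![τ (K.F ξ η) 0 0, τ (K.F ξ η) 1 1, τ (K.F ξ η) 0 1] = (K.ecMode ξ η).mulVec β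

/-- `τ ∈ Z_h`, the discrete kernel for the ECQ4 stress space. -/
structure MemZh {Ω : Set Plane} (ΓD ΓN : Set Plane) (T : QuadMesh Ω)
    (τ : Plane → Matrix (Fin 2) (Fin 2) ℝ) : Prop where
  memSigmaEC : MemSigmaEC ΓN T τ
  orth : ∀ v Dv, MemVh ΓD T v Dv → ∫ x in Ω, contract (τ x) (strain (Dv x)) = 0

/-- Uniform stability of the Q1-P0 pair over a family of meshes. -/
def Q1P0Stable {Ω : Set Plane} (ΓD ΓN : Set Plane) {ι : Type*} (T : ι → QuadMesh Ω) : Prop :=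
  ∃ C : ℝ, 0 < C ∧ ∀ i, ∀ q : Plane → ℝ, MemWbar ΓN (T i) q →
    ∃ v Dv, MemVh ΓD (T i) v Dv ∧
      ∫ x in Ω, q x ^ 2 ≤ C * ∫ x in Ω, q x * (Dv x).trace ∧
      normSq Ω Dv ≤ C * ∫ x in Ω, q x ^ 2

end ECQ4

end

open ECQ4

/-!
For a symmetric stress `τ` the energy `a(τ, τ)` controls the deviator of `τ` with the constant
`1 / (2 μ)`, whatever `lam` is, and the trace only with a constant that degenerates as `lam → ∞`. So
the claim is a bound of `‖tr τ‖₀` by the deviator for `τ ∈ Z_h`. Write `q̄` for the piecewise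
constant projection of `tr τ` (`QuadMesh.cellAverage`).

*Cell averages.* The Q1-P0 stability gives a displacement `v` with `‖q̄‖₀² ≤ C₀ ∫ q̄ div v` and
`|v|₁² ≤ C₀ ‖q̄‖₀²`. Since `∫ τ : ε(v) = 0`, the pairing `∫ q̄ div v` involves only `q̄ - tr τ` and the
deviator of `τ`, so that `‖q̄‖₀` is bounded by these two (`setIntegral_cellAverage_sq_le`).

*Oscillation on an element.* An ECQ4 stress composed with the isoparametric map is affine in `ξ`, `η`.
If `d_K` were zero, its `ξ`- and `η`-coefficients would be multiples of `v ⊗ v` and `u ⊗ u`, where `u`,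
`v` are the columns of the Jacobian matrix at the centre; the trace of a rank-one symmetric tensor
is bounded by its deviator. In general the defect is of order `d_K / |u|`, `d_K / |v|`, measured
against the constant part of `τ` (`sq_trace_le`). The denominators `a₁`, `b₂` in the stress
modes are harmless although they need not be comparable to `h_K`: the two equations for the
rank-one part hold after clearing them, and only `|u|`, `|v|` are compared with `h_K`. By shape
regularity the Jacobian determinant lies between multiples of `h_K ^ 2`, so estimates on
the reference square transfer to the element
(`Quad.setIntegral_cell_trace_sub_average_le`). By Condition (A), for small `h` this gives
`‖tr τ - q̄‖₀² ≤ C (‖dev τ‖₀² + ε ‖tr τ‖₀²)` with `ε` as small as desired, and the last term is absorbed.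

To sum over elements, the open elements (`Quad.cell`, the images of the open square) must be
disjoint and exhaust `Ω` up to a null set; that the isoparametric map is onto the interior of the
convex hull is a connectedness argument (`Quad.interior_carrier_subset_cell`).
-/

noncomputable section

namespace ECQ4

/-! ### Triangles -/

lemma cross_combo (A B x y : Plane) (a b : ℝ) (h : a + b = 1) :
    cross A B (a • x + b • y) = a * cross A B x + b * cross A B y := by
  obtain rfl : b = 1 - a := by linarith
  simp [cross]
  ring

lemma convex_cross_nonneg (A B : Plane) : Convex ℝ {P | 0 ≤ cross A B P} := by
  intro x hx y hy a b ha hb hab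
  simp only [Set.mem_ofPred_eq] at *
  rw [cross_combo _ _ _ _ _ _ hab]
  positivity

lemma convex_cross_le (A B : Plane) (m : ℝ) : Convex ℝ {P | cross A B P ≤ m} := by
  intro x hx y hy a b ha hb hab
  simp only [Set.mem_ofPred_eq] at *
  rw [cross_combo _ _ _ _ _ _ hab]
  obtain rfl : b = 1 - a := by linarith
  nlinarith

lemma cross_rotate (A B C : Plane) : cross B C A = cross A B C := by
  simp only [cross]; ring

lemma cross_self_left (A B : Plane) : cross A B A = 0 := by
  simp only [cross]; ring

lemma cross_self_right (A B : Plane) : cross A B B = 0 := by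
  simp only [cross]; ring

lemma dist_sq (A B : Plane) : dist A B ^ 2 = (B 0 - A 0) ^ 2 + (B 1 - A 1) ^ 2 := by
  rw [EuclideanSpace.dist_eq, Real.sq_sqrt (by positivity)]
  simp only [Fin.sum_univ_two, Real.dist_eq, sq_abs]
  ring

lemma abs_cross_le (A B C : Plane) : |cross A B C| ≤ dist A B * dist A C := by
  refine abs_le_of_sq_le_sq ?_ (by positivity)
  rw [mul_pow, dist_sq, dist_sq, cross]
  nlinarith [sq_nonneg ((B 0 - A 0) * (C 0 - A 0) + (B 1 - A 1) * (C 1 - A 1))]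

/-- Over a disc of diameter `2 r`, the affine function `cross A B` varies by `2 r * dist A B`;
over the triangle it varies between `0` and `cross A B C`. -/
lemma two_mul_radius_mul_dist_le_cross {A B C c : Plane} {r : ℝ} (h : 0 ≤ cross A B C)
    (hb : Metric.closedBall c r ⊆ convexHull ℝ {A, B, C}) (hr : 0 ≤ r) :
    2 * r * dist A B ≤ cross A B C := by
  rcases eq_or_ne A B with rfl | hAB
  · simpa using h
  have hd : 0 < dist A B := dist_pos.mpr hAB
  have h0 : convexHull ℝ {A, B, C} ⊆ {P | 0 ≤ cross A B P} := by
    refine convexHull_min ?_ (convex_cross_nonneg A B)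
    rintro P (rfl | rfl | rfl) <;> simp [cross_self_left, cross_self_right, h]
  have h1 : convexHull ℝ {A, B, C} ⊆ {P | cross A B P ≤ cross A B C} := by
    refine convexHull_min ?_ (convex_cross_le A B _)
    rintro P (rfl | rfl | rfl) <;> simp [cross_self_left, cross_self_right, h]
  set n : Plane := pt (A 1 - B 1) (B 0 - A 0) with hn
  have hnn : ‖n‖ = dist A B := by
    rw [← sq_eq_sq₀ (norm_nonneg _) dist_nonneg, dist_sq, EuclideanSpace.norm_eq,
      Real.sq_sqrt (by positivity)]
    simp [hn, pt]; ring
  have hball : ∀ s : ℝ, |s| ≤ r → c + (s / dist A B) • n ∈ Metric.closedBall c r := by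
    intro s hs
    rw [Metric.mem_closedBall, dist_self_add_left, norm_smul, hnn, Real.norm_eq_abs, abs_div,
      abs_of_pos hd, div_mul_cancel₀ _ hd.ne']
    exact hs
  have hval : ∀ s : ℝ, cross A B (c + (s / dist A B) • n) = cross A B c + s * dist A B := by
    intro s
    have : cross A B (c + (s / dist A B) • n) = cross A B c + s / dist A B * dist A B ^ 2 := by
      rw [dist_sq]
      simp [cross, hn, pt]; ring
    rw [this]
    field_simp
  have hp := h1 (hb (hball r (by rw [abs_of_nonneg hr])))
  have hm := h0 (hb (hball (-r) (by rw [abs_neg, abs_of_nonneg hr])))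
  simp only [Set.mem_ofPred_eq, hval] at hp hm
  linarith

/-- Twice the area of a triangle is at least the squared diameter of any inscribed disc: it is at
least the disc diameter times either of two sides, and at most the product of those sides. -/
lemma sq_diam_le_cross {A B C c : Plane} {r : ℝ} (h : 0 < cross A B C)
    (hb : Metric.closedBall c r ⊆ convexHull ℝ {A, B, C}) (hr : 0 ≤ r) :
    (2 * r) ^ 2 ≤ cross A B C := by
  have h1 := two_mul_radius_mul_dist_le_cross h.le hb hr
  have h2 : 2 * r * dist A C ≤ cross A B C := by
    rw [← cross_rotate, ← cross_rotate, dist_comm]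
    refine two_mul_radius_mul_dist_le_cross (c := c) (by rw [cross_rotate, cross_rotate]; exact h.le) ?_ hr
    convert hb using 2
    ext; simp only [Set.mem_insert_iff, Set.mem_singleton_iff]; tauto
  have h3 := (le_abs_self _).trans (abs_cross_le A B C)
  have h4 : (2 * r) ^ 2 * cross A B C ≤ cross A B C * cross A B C :=
    calc (2 * r) ^ 2 * cross A B C ≤ (2 * r) ^ 2 * (dist A B * dist A C) := by gcongr
      _ = (2 * r * dist A B) * (2 * r * dist A C) := by ring
      _ ≤ _ := by gcongr
  exact le_of_mul_le_mul_right h4 h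

namespace Quad

lemma sq_le_cross_of_lt_inscribedDiam {A B C : Plane} {s : ℝ} (h : 0 < cross A B C) (hs : 0 ≤ s)
    (hlt : s < inscribedDiam A B C) : s ^ 2 ≤ cross A B C := by
  have hne : {d : ℝ | ∃ (c : Plane) (r : ℝ), 0 ≤ r ∧ d = 2 * r ∧
      Metric.closedBall c r ⊆ convexHull ℝ {A, B, C}}.Nonempty := by
    refine ⟨0, A, 0, le_rfl, by simp, ?_⟩
    rw [Metric.closedBall_zero, Set.singleton_subset_iff]
    exact subset_convexHull ℝ _ (by simp)
  obtain ⟨d, ⟨c, r, hr, rfl, hb⟩, hd⟩ := exists_lt_of_lt_csSup hne hlt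
  exact (pow_le_pow_left₀ hs hd.le 2).trans (sq_diam_le_cross h hb hr)

/-! ### The geometry of a quadrilateral -/

lemma z_mem_carrier (K : Quad) (i : Fin 4) : K.z i ∈ K.carrier :=
  subset_convexHull ℝ _ ⟨i, rfl⟩

lemma isCompact_carrier (K : Quad) : IsCompact K.carrier :=
  (Set.finite_range K.z).isCompact_convexHull (𝕜 := ℝ)

lemma convex_carrier (K : Quad) : Convex ℝ K.carrier := convex_convexHull ℝ _

lemma dist_le_diam (K : Quad) (i j : Fin 4) : dist (K.z i) (K.z j) ≤ K.diam :=
  Metric.dist_le_diam_of_mem K.isCompact_carrier.isBounded (K.z_mem_carrier i) (K.z_mem_carrier j)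

lemma diam_nonneg (K : Quad) : 0 ≤ K.diam := Metric.diam_nonneg

lemma abs_cross_le_diam_sq (K : Quad) (i j k : Fin 4) :
    |cross (K.z i) (K.z j) (K.z k)| ≤ K.diam ^ 2 := by
  refine (abs_cross_le _ _ _).trans ?_
  rw [sq]
  exact mul_le_mul (K.dist_le_diam _ _) (K.dist_le_diam _ _) dist_nonneg K.diam_nonneg

lemma ccw_pred (K : Quad) (i : Fin 4) : 0 < cross (K.z (i - 1)) (K.z i) (K.z (i + 1)) := by
  have := K.ccw (i - 1)
  rwa [sub_add_cancel, show i - 1 + 2 = i + 1 by omega] at this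

lemma diam_pos (K : Quad) : 0 < K.diam := by
  have h := (abs_of_pos (K.ccw 0) ▸ K.abs_cross_le_diam_sq 0 (0 + 1) (0 + 2))
  have h' := K.ccw 0
  rcases K.diam_nonneg.eq_or_lt with h0 | h0
  · rw [← h0] at h; linarith
  · exact h0

/-- In a shape regular quadrilateral the triangles spanned by three consecutive vertices have
area of order `h_K ^ 2`. -/
lemma diam_sq_le_cross {K : Quad} {ϱ : ℝ} (hϱ : 0 < ϱ) (h : K.diam ≤ ϱ * K.rho) (i : Fin 4) :
    K.diam ^ 2 / (4 * ϱ ^ 2) ≤ cross (K.z (i - 1)) (K.z i) (K.z (i + 1)) := by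
  have hr : K.rho ≤ inscribedDiam (K.z (i - 1)) (K.z i) (K.z (i + 1)) :=
    ciInf_le (Set.finite_range _).bddBelow i
  have hd := K.diam_pos
  have hlt : K.diam / (2 * ϱ) < inscribedDiam (K.z (i - 1)) (K.z i) (K.z (i + 1)) := by
    refine lt_of_lt_of_le ?_ hr
    rw [div_lt_iff₀ (by positivity)]
    nlinarith
  have := sq_le_cross_of_lt_inscribedDiam (K.ccw_pred i) (by positivity) hlt
  convert this using 1
  field_simp
  ring

/-- The Jacobian determinant of the isoparametric map. -/
def jac (K : Quad) (ξ η : ℝ) : ℝ :=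
  (K.a₁ + K.a₁₂ * η) * (K.b₂ + K.b₁₂ * ξ) - (K.a₂ + K.a₁₂ * ξ) * (K.b₁ + K.b₁₂ * η)

/-- The Jacobian determinant is affine, and so interpolates its values at the four corners. -/
lemma jac_eq (K : Quad) (ξ η : ℝ) : K.jac ξ η =
    (1 - ξ) * (1 - η) / 4 * (cross (K.z 3) (K.z 0) (K.z 1) / 4) +
    (1 + ξ) * (1 - η) / 4 * (cross (K.z 0) (K.z 1) (K.z 2) / 4) +
    (1 + ξ) * (1 + η) / 4 * (cross (K.z 1) (K.z 2) (K.z 3) / 4) +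
    (1 - ξ) * (1 + η) / 4 * (cross (K.z 2) (K.z 3) (K.z 0) / 4) := by
  simp only [jac, a₁, a₂, a₁₂, b₁, b₂, b₁₂, cross]
  ring

lemma le_jac {K : Quad} {m ξ η : ℝ} (hξ : ξ ∈ Set.Icc (-1 : ℝ) 1) (hη : η ∈ Set.Icc (-1 : ℝ) 1)
    (h : ∀ i : Fin 4, m ≤ cross (K.z (i - 1)) (K.z i) (K.z (i + 1))) : m / 4 ≤ K.jac ξ η := by
  have h0 := h 0
  have h1 := h 1
  have h2 := h 2
  have h3 := h 3
  simp only [Fin.reduceAdd, Fin.reduceSub, zero_sub, zero_add, show (-1 : Fin 4) = 3 from rfl,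
    show (1 - 1 : Fin 4) = 0 from rfl] at h0 h1 h2 h3
  have e1 : 0 ≤ 1 - ξ := by linarith [hξ.2]
  have e2 : 0 ≤ 1 + ξ := by linarith [hξ.1]
  have e3 : 0 ≤ 1 - η := by linarith [hη.2]
  have e4 : 0 ≤ 1 + η := by linarith [hη.1]
  rw [jac_eq]
  calc m / 4 = (1 - ξ) * (1 - η) / 4 * (m / 4) + (1 + ξ) * (1 - η) / 4 * (m / 4) +
      (1 + ξ) * (1 + η) / 4 * (m / 4) + (1 - ξ) * (1 + η) / 4 * (m / 4) := by ring
    _ ≤ _ := by gcongr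

lemma jac_le {K : Quad} {ξ η : ℝ} (hξ : ξ ∈ Set.Icc (-1 : ℝ) 1) (hη : η ∈ Set.Icc (-1 : ℝ) 1) :
    K.jac ξ η ≤ K.diam ^ 2 / 4 := by
  have h : ∀ i j k, cross (K.z i) (K.z j) (K.z k) ≤ K.diam ^ 2 := fun i j k =>
    (le_abs_self _).trans (K.abs_cross_le_diam_sq i j k)
  have e1 : 0 ≤ 1 - ξ := by linarith [hξ.2]
  have e2 : 0 ≤ 1 + ξ := by linarith [hξ.1]
  have e3 : 0 ≤ 1 - η := by linarith [hη.2]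
  have e4 : 0 ≤ 1 + η := by linarith [hη.1]
  rw [jac_eq]
  calc _ ≤ (1 - ξ) * (1 - η) / 4 * (K.diam ^ 2 / 4) + (1 + ξ) * (1 - η) / 4 * (K.diam ^ 2 / 4) +
      (1 + ξ) * (1 + η) / 4 * (K.diam ^ 2 / 4) + (1 - ξ) * (1 + η) / 4 * (K.diam ^ 2 / 4) := by
        gcongr <;> apply h
    _ = _ := by ring

lemma jac_pos {K : Quad} {ξ η : ℝ} (hξ : ξ ∈ Set.Icc (-1 : ℝ) 1) (hη : η ∈ Set.Icc (-1 : ℝ) 1) :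
    0 < K.jac ξ η := by
  obtain ⟨i, hi⟩ := Finite.exists_min fun i : Fin 4 => cross (K.z (i - 1)) (K.z i) (K.z (i + 1))
  have := le_jac hξ hη hi
  have := K.ccw_pred i
  linarith

lemma le_jac_of_shapeRegular {K : Quad} {ϱ ξ η : ℝ} (hϱ : 0 < ϱ) (h : K.diam ≤ ϱ * K.rho)
    (hξ : ξ ∈ Set.Icc (-1 : ℝ) 1) (hη : η ∈ Set.Icc (-1 : ℝ) 1) :
    K.diam ^ 2 / (16 * ϱ ^ 2) ≤ K.jac ξ η := by
  have := le_jac hξ hη (diam_sq_le_cross hϱ h)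
  convert this using 1
  field_simp
  ring

lemma diagDist_sq (K : Quad) : K.diagDist ^ 2 = 4 * (K.a₁₂ ^ 2 + K.b₁₂ ^ 2) := by
  rw [diagDist, dist_sq]
  simp only [midpoint_eq_smul_add, PiLp.smul_apply, PiLp.add_apply, smul_eq_mul, a₁₂, b₁₂,
    invOf_eq_inv]
  ring

lemma abs_coord_sub_le (K : Quad) (i j : Fin 4) (k : Fin 2) : |K.z i k - K.z j k| ≤ K.diam := by
  refine le_trans ?_ (K.dist_le_diam i j)
  rw [dist_eq_norm]
  exact PiLp.norm_apply_le (K.z i - K.z j) k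

lemma sq_a₁_add_sq_b₁_le (K : Quad) : K.a₁ ^ 2 + K.b₁ ^ 2 ≤ K.diam ^ 2 / 2 := by
  have h : ∀ k, |(-K.z 0 k + K.z 1 k + K.z 2 k - K.z 3 k) / 4| ≤ K.diam / 2 := by
    intro k
    have h1 := abs_le.mp (K.abs_coord_sub_le 1 0 k)
    have h2 := abs_le.mp (K.abs_coord_sub_le 2 3 k)
    rw [abs_le]
    constructor <;> linarith
  have h0 := sq_le_sq' (abs_le.mp (h 0)).1 (abs_le.mp (h 0)).2
  have h1 := sq_le_sq' (abs_le.mp (h 1)).1 (abs_le.mp (h 1)).2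
  rw [a₁, b₁]
  linarith

lemma sq_a₂_add_sq_b₂_le (K : Quad) : K.a₂ ^ 2 + K.b₂ ^ 2 ≤ K.diam ^ 2 / 2 := by
  have h : ∀ k, |(-K.z 0 k - K.z 1 k + K.z 2 k + K.z 3 k) / 4| ≤ K.diam / 2 := by
    intro k
    have h1 := abs_le.mp (K.abs_coord_sub_le 2 1 k)
    have h2 := abs_le.mp (K.abs_coord_sub_le 3 0 k)
    rw [abs_le]
    constructor <;> linarith
  have h0 := sq_le_sq' (abs_le.mp (h 0)).1 (abs_le.mp (h 0)).2
  have h1 := sq_le_sq' (abs_le.mp (h 1)).1 (abs_le.mp (h 1)).2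
  rw [a₂, b₂]
  linarith

/-- Both columns of the Jacobian matrix at the centre have length of order `h_K`: their lengths are
at most of that order, and the determinant is of order `h_K ^ 2`. The individual entries `a₁` and
`b₂` have no such lower bound. -/
lemma le_sq_columns {K : Quad} {ϱ : ℝ} (hϱ : 0 < ϱ) (h : K.diam ≤ ϱ * K.rho) :
    K.diam ^ 2 / (128 * ϱ ^ 4) ≤ K.a₁ ^ 2 + K.b₁ ^ 2 ∧
      K.diam ^ 2 / (128 * ϱ ^ 4) ≤ K.a₂ ^ 2 + K.b₂ ^ 2 := by
  have hJ := le_jac_of_shapeRegular (ξ := 0) (η := 0) hϱ h (by simp) (by simp)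
  have hd := K.diam_pos
  have hJ2 : (K.diam ^ 2 / (16 * ϱ ^ 2)) ^ 2 ≤
      (K.a₁ ^ 2 + K.b₁ ^ 2) * (K.a₂ ^ 2 + K.b₂ ^ 2) := by
    refine (pow_le_pow_left₀ (by positivity) hJ 2).trans ?_
    simp only [jac]
    nlinarith [sq_nonneg (K.a₁ * K.a₂ + K.b₁ * K.b₂)]
  have key : ∀ x y : ℝ, 0 ≤ x → y ≤ K.diam ^ 2 / 2 →
      (K.diam ^ 2 / (16 * ϱ ^ 2)) ^ 2 ≤ x * y → K.diam ^ 2 / (128 * ϱ ^ 4) ≤ x := by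
    intro x y hx hy hxy
    have h1 : (K.diam ^ 2 / (16 * ϱ ^ 2)) ^ 2 ≤ x * (K.diam ^ 2 / 2) :=
      hxy.trans (by gcongr)
    have h2 : K.diam ^ 2 / (128 * ϱ ^ 4) * (K.diam ^ 2 / 2) ≤ x * (K.diam ^ 2 / 2) := by
      convert h1 using 1
      field_simp
      norm_num
    exact le_of_mul_le_mul_right h2 (by positivity)
  exact ⟨key _ _ (by positivity) K.sq_a₂_add_sq_b₂_le hJ2,
    key _ _ (by positivity) K.sq_a₁_add_sq_b₁_le (by rwa [mul_comm (K.a₂ ^ 2 + _)])⟩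

end Quad

/-- An open subset of a closed half-plane avoids the bounding line. -/
lemma cross_pos_of_isOpen {A B P : Plane} {U : Set Plane} (hAB : A ≠ B) (hU : IsOpen U)
    (hsub : U ⊆ {P | 0 ≤ cross A B P}) (hP : P ∈ U) : 0 < cross A B P := by
  set n : Plane := pt (A 1 - B 1) (B 0 - A 0) with hn
  have hc : Tendsto (fun t : ℝ => P - t • n) (𝓝[>] 0) (𝓝 P) := by
    have : Continuous fun t : ℝ => P - t • n := by fun_prop
    simpa using (this.tendsto 0).mono_left nhdsWithin_le_nhds
  obtain ⟨t, ht, ht0⟩ := ((hc.eventually (hU.mem_nhds hP)).and self_mem_nhdsWithin).exists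
  have h := hsub ht
  have hval : cross A B (P - t • n) = cross A B P - t * dist A B ^ 2 := by
    rw [dist_sq]
    simp [cross, hn, pt]; ring
  have hd : 0 < dist A B := dist_pos.mpr hAB
  have ht0 : 0 < t := ht0
  simp only [Set.mem_ofPred_eq, hval] at h
  have : 0 < t * dist A B ^ 2 := by positivity
  linarith

/-! ### The reference square -/

/-- The open reference square `(-1,1)²`. -/
def refSquare : Set Plane := {p | p 0 ∈ Set.Ioo (-1 : ℝ) 1 ∧ p 1 ∈ Set.Ioo (-1 : ℝ) 1}

lemma isOpen_refSquare : IsOpen refSquare :=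
  (isOpen_Ioo.preimage (EuclideanSpace.proj (𝕜 := ℝ) (0 : Fin 2)).continuous).inter
    (isOpen_Ioo.preimage (EuclideanSpace.proj (𝕜 := ℝ) (1 : Fin 2)).continuous)

lemma setIntegral_refSquare (f : ℝ → ℝ → ℝ) :
    ∫ p in refSquare, f (p 0) (p 1) =
      ∫ z in Set.Ioo (-1 : ℝ) 1 ×ˢ Set.Ioo (-1 : ℝ) 1, f z.1 z.2 := by
  have hmp : MeasurePreserving (MeasurableEquiv.finTwoArrow ∘ (WithLp.ofLp : Plane → _))
      volume (volume.prod volume) :=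
    (volume_preserving_finTwoArrow ℝ).comp (PiLp.volume_preserving_ofLp (Fin 2))
  have hemb : MeasurableEmbedding (MeasurableEquiv.finTwoArrow ∘ (WithLp.ofLp : Plane → _)) :=
    (MeasurableEquiv.finTwoArrow (α := ℝ)).measurableEmbedding.comp
      (MeasurableEquiv.toLp 2 (Fin 2 → ℝ)).symm.measurableEmbedding
  exact hmp.setIntegral_preimage_emb hemb (fun z => f z.1 z.2)
    (Set.Ioo (-1 : ℝ) 1 ×ˢ Set.Ioo (-1 : ℝ) 1)

/-- The functions `1`, `ξ`, `η` are orthogonal on the reference square. -/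
lemma setIntegral_refSquare_affine_sq (p₀ p₁ p₂ : ℝ) :
    ∫ p in refSquare, (p₀ + p₁ * p 0 + p₂ * p 1) ^ 2 =
      4 * p₀ ^ 2 + 4 / 3 * (p₁ ^ 2 + p₂ ^ 2) := by
  rw [setIntegral_refSquare (fun x y => (p₀ + p₁ * x + p₂ * y) ^ 2), Measure.volume_eq_prod,
    setIntegral_prod]
  · simp only [← integral_Ioc_eq_integral_Ioo, ← intervalIntegral.integral_of_le
      (show (-1 : ℝ) ≤ 1 by norm_num)]
    have h : ∀ x : ℝ, ∫ y in (-1 : ℝ)..1, (p₀ + p₁ * x + p₂ * y) ^ 2 =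
        2 * (p₀ + p₁ * x) ^ 2 + 2 / 3 * p₂ ^ 2 := by
      intro x
      have : ∀ y : ℝ, HasDerivAt (fun y => (p₀ + p₁ * x) ^ 2 * y +
          (p₀ + p₁ * x) * p₂ * y ^ 2 + p₂ ^ 2 / 3 * y ^ 3) ((p₀ + p₁ * x + p₂ * y) ^ 2) y := by
        intro y
        refine HasDerivAt.congr_deriv (((((hasDerivAt_id y).const_mul ((p₀ + p₁ * x) ^ 2)).add
          ((hasDerivAt_pow 2 y).const_mul ((p₀ + p₁ * x) * p₂))).add
          ((hasDerivAt_pow 3 y).const_mul (p₂ ^ 2 / 3)))) ?_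
        norm_num; ring
      rw [intervalIntegral.integral_eq_sub_of_hasDerivAt (fun y _ => this y)
        (Continuous.intervalIntegrable (by fun_prop) _ _)]
      ring
    simp only [h]
    have : ∀ x : ℝ, HasDerivAt (fun x => (2 * p₀ ^ 2 + 2 / 3 * p₂ ^ 2) * x +
        2 * p₀ * p₁ * x ^ 2 + 2 * p₁ ^ 2 / 3 * x ^ 3)
        (2 * (p₀ + p₁ * x) ^ 2 + 2 / 3 * p₂ ^ 2) x := by
      intro x
      refine HasDerivAt.congr_deriv (((((hasDerivAt_id x).const_mul (2 * p₀ ^ 2 + 2 / 3 * p₂ ^ 2)).add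
        ((hasDerivAt_pow 2 x).const_mul (2 * p₀ * p₁))).add
        ((hasDerivAt_pow 3 x).const_mul (2 * p₁ ^ 2 / 3)))) ?_
      norm_num; ring
    rw [intervalIntegral.integral_eq_sub_of_hasDerivAt (fun y _ => this y)
      (Continuous.intervalIntegrable (by fun_prop) _ _)]
    ring
  · refine (Continuous.integrableOn_Icc (a := ((-1, -1) : ℝ × ℝ)) (b := (1, 1))
      (by fun_prop)).mono_set ?_
    rw [← Set.Icc_prod_Icc]
    exact Set.prod_mono Set.Ioo_subset_Icc_self Set.Ioo_subset_Icc_self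

lemma refSquare_subset_closedBall : refSquare ⊆ Metric.closedBall (0 : Plane) 2 := by
  intro p hp
  rw [mem_closedBall_zero_iff, EuclideanSpace.norm_eq, Real.sqrt_le_left (by norm_num)]
  simp only [Fin.sum_univ_two, Real.norm_eq_abs, sq_abs]
  obtain ⟨⟨h1, h2⟩, h3, h4⟩ := hp
  nlinarith

lemma integrableOn_refSquare {f : Plane → ℝ} (hf : Continuous f) : IntegrableOn f refSquare :=
  (hf.continuousOn.integrableOn_compact (isCompact_closedBall 0 2)).mono_set
    refSquare_subset_closedBall

namespace Quad

/-! ### The isoparametric map and the open elements -/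

/-- The isoparametric map as a map of the plane. -/
def map (K : Quad) (p : Plane) : Plane := K.F (p 0) (p 1)

/-- The open element, the image of the open reference square. -/
def cell (K : Quad) : Set Plane := K.map '' refSquare

lemma map_zero_coord (K : Quad) (p : Plane) : K.map p 0 =
    (K.z 0 0 + K.z 1 0 + K.z 2 0 + K.z 3 0) / 4 + K.a₁ * p 0 + K.a₂ * p 1 +
      K.a₁₂ * (p 0 * p 1) := by
  simp [map, F, a₁, a₂, a₁₂]; ring

lemma map_one_coord (K : Quad) (p : Plane) : K.map p 1 =
    (K.z 0 1 + K.z 1 1 + K.z 2 1 + K.z 3 1) / 4 + K.b₁ * p 0 + K.b₂ * p 1 +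
      K.b₁₂ * (p 0 * p 1) := by
  simp [map, F, b₁, b₂, b₁₂]; ring

/-- The derivative of the isoparametric map. -/
def deriv (K : Quad) (p : Plane) : Plane →L[ℝ] Plane :=
  (EuclideanSpace.proj (0 : Fin 2)).smulRight (pt (K.a₁ + K.a₁₂ * p 1) (K.b₁ + K.b₁₂ * p 1)) +
  (EuclideanSpace.proj (1 : Fin 2)).smulRight (pt (K.a₂ + K.a₁₂ * p 0) (K.b₂ + K.b₁₂ * p 0))

lemma hasStrictFDerivAt_map (K : Quad) (p : Plane) : HasStrictFDerivAt K.map (K.deriv p) p := by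
  rw [hasStrictFDerivAt_euclidean]
  have h0 := (EuclideanSpace.proj (𝕜 := ℝ) (0 : Fin 2)).hasStrictFDerivAt (x := p)
  have h1 := (EuclideanSpace.proj (𝕜 := ℝ) (1 : Fin 2)).hasStrictFDerivAt (x := p)
  intro i
  fin_cases i
  · simp only [Fin.zero_eta, map_zero_coord]
    refine HasStrictFDerivAt.congr_fderiv ((((hasStrictFDerivAt_const _ _).add
      (h0.const_mul K.a₁)).add (h1.const_mul K.a₂)).add ((h0.mul h1).const_mul K.a₁₂)) ?_
    ext q
    simp [deriv, pt]; ring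
  · simp only [Fin.mk_one, map_one_coord]
    refine HasStrictFDerivAt.congr_fderiv ((((hasStrictFDerivAt_const _ _).add
      (h0.const_mul K.b₁)).add (h1.const_mul K.b₂)).add ((h0.mul h1).const_mul K.b₁₂)) ?_
    ext q
    simp [deriv, pt]; ring

lemma continuous_map (K : Quad) : Continuous K.map :=
  continuous_iff_continuousAt.mpr fun p => (K.hasStrictFDerivAt_map p).continuousAt

lemma det_deriv (K : Quad) (p : Plane) : (K.deriv p).det = K.jac (p 0) (p 1) := by
  rw [ContinuousLinearMap.det,
    ← LinearMap.det_toMatrix (EuclideanSpace.basisFun (Fin 2) ℝ).toBasis, Matrix.det_fin_two]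
  simp [LinearMap.toMatrix_apply, deriv, pt, jac]

/-- A difference of two values of a bilinear map is given exactly by the derivative at the
midpoint, where the Jacobian determinant is positive. -/
lemma injOn_map (K : Quad) : Set.InjOn K.map refSquare := by
  intro p hp q hq h
  have hJ : 0 < K.jac ((p 0 + q 0) / 2) ((p 1 + q 1) / 2) := by
    obtain ⟨⟨h1, h2⟩, h3, h4⟩ := hp
    obtain ⟨⟨h5, h6⟩, h7, h8⟩ := hq
    apply jac_pos <;> constructor <;> linarith
  have e0 := congrArg (fun x : Plane => x 0) h
  have e1 := congrArg (fun x : Plane => x 1) h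
  simp only [map_zero_coord, map_one_coord] at e0 e1
  have d0 : K.jac ((p 0 + q 0) / 2) ((p 1 + q 1) / 2) * (p 0 - q 0) = 0 := by
    simp only [jac]
    linear_combination (K.b₂ + K.b₁₂ * ((p 0 + q 0) / 2)) * e0 -
      (K.a₂ + K.a₁₂ * ((p 0 + q 0) / 2)) * e1
  have d1 : K.jac ((p 0 + q 0) / 2) ((p 1 + q 1) / 2) * (p 1 - q 1) = 0 := by
    simp only [jac]
    linear_combination (K.a₁ + K.a₁₂ * ((p 1 + q 1) / 2)) * e1 -
      (K.b₁ + K.b₁₂ * ((p 1 + q 1) / 2)) * e0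
  have d0 := (mul_eq_zero.mp d0).resolve_left hJ.ne'
  have d1 := (mul_eq_zero.mp d1).resolve_left hJ.ne'
  ext i
  fin_cases i
  · simpa using sub_eq_zero.mp d0
  · simpa using sub_eq_zero.mp d1

lemma jac_pos_of_mem (K : Quad) {p : Plane} (hp : p ∈ refSquare) : 0 < K.jac (p 0) (p 1) :=
  jac_pos (Set.Ioo_subset_Icc_self hp.1) (Set.Ioo_subset_Icc_self hp.2)

lemma isOpen_cell (K : Quad) : IsOpen K.cell := by
  rw [isOpen_iff_mem_nhds]
  rintro _ ⟨p, hp, rfl⟩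
  have hsurj : (K.deriv p).range = ⊤ := by
    refine (LinearMap.isUnit_iff_range_eq_top _).mp ?_
    rw [LinearMap.isUnit_iff_isUnit_det, isUnit_iff_ne_zero]
    exact (K.det_deriv p).trans_ne (K.jac_pos_of_mem hp).ne'
  rw [← (K.hasStrictFDerivAt_map p).map_nhds_eq_of_surj hsurj]
  exact image_mem_map (isOpen_refSquare.mem_nhds hp)

lemma setIntegral_cell (K : Quad) (f : Plane → ℝ) :
    ∫ x in K.cell, f x = ∫ p in refSquare, K.jac (p 0) (p 1) * f (K.map p) := by
  rw [cell, integral_image_eq_integral_abs_det_fderiv_smul volume isOpen_refSquare.measurableSet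
    (fun p _ => (K.hasStrictFDerivAt_map p).hasFDerivAt.hasFDerivWithinAt) K.injOn_map]
  refine setIntegral_congr_fun isOpen_refSquare.measurableSet fun p hp => ?_
  simp only [det_deriv, abs_of_pos (K.jac_pos_of_mem hp), smul_eq_mul]

lemma F_mem_carrier (K : Quad) {ξ η : ℝ} (hξ : ξ ∈ Set.Icc (-1 : ℝ) 1)
    (hη : η ∈ Set.Icc (-1 : ℝ) 1) : K.F ξ η ∈ K.carrier := by
  have e1 : 0 ≤ 1 - ξ := by linarith [hξ.2]
  have e2 : 0 ≤ 1 + ξ := by linarith [hξ.1]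
  have e3 : 0 ≤ 1 - η := by linarith [hη.2]
  have e4 : 0 ≤ 1 + η := by linarith [hη.1]
  have := K.convex_carrier.sum_mem (t := Finset.univ) (z := K.z)
    (w := ![(1 - ξ) * (1 - η) / 4, (1 + ξ) * (1 - η) / 4, (1 + ξ) * (1 + η) / 4,
      (1 - ξ) * (1 + η) / 4]) (by
        intro i _
        fin_cases i <;> simp <;> positivity)
    (by simp [Fin.sum_univ_four]; ring) (fun i _ => K.z_mem_carrier i)
  simpa [Fin.sum_univ_four, F] using this

lemma cell_subset_carrier (K : Quad) : K.cell ⊆ K.carrier := by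
  rintro _ ⟨p, hp, rfl⟩
  exact K.F_mem_carrier (Set.Ioo_subset_Icc_self hp.1) (Set.Ioo_subset_Icc_self hp.2)

lemma volume_cell_ne_top (K : Quad) : volume K.cell ≠ ⊤ :=
  ((K.isCompact_carrier.isBounded.subset K.cell_subset_carrier).measure_lt_top).ne

lemma z_ne_z_succ (K : Quad) (i : Fin 4) : K.z i ≠ K.z (i + 1) := by
  intro h
  have := K.ccw i
  rw [← h] at this
  simp [cross] at this

/-- Every vertex lies on the left of every edge. -/
lemma carrier_subset_halfPlane (K : Quad) (i : Fin 4) :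
    K.carrier ⊆ {P | 0 ≤ cross (K.z i) (K.z (i + 1)) P} := by
  refine convexHull_min ?_ (convex_cross_nonneg _ _)
  rintro _ ⟨j, rfl⟩
  simp only [Set.mem_ofPred_eq]
  obtain rfl | rfl | rfl | rfl : j = i ∨ j = i + 1 ∨ j = i + 2 ∨ j = i - 1 := by omega
  · exact (cross_self_left _ _).ge
  · exact (cross_self_right _ _).ge
  · exact (K.ccw i).le
  · rw [cross_rotate]
    exact (K.ccw_pred i).le

lemma cross_pos_of_mem_interior (K : Quad) (i : Fin 4) {P : Plane} (hP : P ∈ interior K.carrier) :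
    0 < cross (K.z i) (K.z (i + 1)) P :=
  cross_pos_of_isOpen (K.z_ne_z_succ i) isOpen_interior
    (interior_subset.trans (K.carrier_subset_halfPlane i)) hP

/-- The open element is relatively closed in the connected interior of the element, because the
isoparametric map sends the sides of the square into the boundary of the element. -/
lemma interior_carrier_subset_cell (K : Quad) : interior K.carrier ⊆ K.cell := by
  have hsub : K.cell ⊆ interior K.carrier := interior_maximal K.cell_subset_carrier K.isOpen_cell
  have h0 : (0 : Plane) ∈ refSquare := by simp [refSquare]
  refine K.convex_carrier.interior.isPreconnected.subset_of_closure_inter_subset K.isOpen_cell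
    ⟨K.map 0, hsub ⟨0, h0, rfl⟩, 0, h0, rfl⟩ ?_
  rintro P ⟨hP, hPi⟩
  set S : Set Plane := {p | p 0 ∈ Set.Icc (-1 : ℝ) 1 ∧ p 1 ∈ Set.Icc (-1 : ℝ) 1} with hS
  have hScl : IsClosed S :=
    (isClosed_Icc.preimage (EuclideanSpace.proj (𝕜 := ℝ) (0 : Fin 2)).continuous).inter
      (isClosed_Icc.preimage (EuclideanSpace.proj (𝕜 := ℝ) (1 : Fin 2)).continuous)
  have hSb : Bornology.IsBounded S := by
    refine (Metric.isBounded_iff_subset_closedBall (0 : Plane)).mpr ⟨2, ?_⟩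
    intro p hp
    rw [mem_closedBall_zero_iff, EuclideanSpace.norm_eq, Real.sqrt_le_left (by norm_num)]
    simp only [Fin.sum_univ_two, Real.norm_eq_abs, sq_abs]
    obtain ⟨⟨h1, h2⟩, h3, h4⟩ := hp
    nlinarith
  have hScpt : IsCompact S := Metric.isCompact_of_isClosed_isBounded hScl hSb
  have hcl : closure K.cell ⊆ K.map '' S :=
    closure_minimal (Set.image_mono fun p hp =>
      ⟨Set.Ioo_subset_Icc_self hp.1, Set.Ioo_subset_Icc_self hp.2⟩)
      (hScpt.image K.continuous_map).isClosed
  obtain ⟨p, ⟨⟨h1, h2⟩, h3, h4⟩, rfl⟩ := hcl hP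
  have c0 := K.cross_pos_of_mem_interior 0 hPi
  have c1 := K.cross_pos_of_mem_interior 1 hPi
  have c2 := K.cross_pos_of_mem_interior 2 hPi
  have c3 := K.cross_pos_of_mem_interior 3 hPi
  simp only [Fin.reduceAdd, zero_add] at c0 c1 c2 c3
  refine ⟨p, ⟨⟨lt_of_le_of_ne h1 ?_, lt_of_le_of_ne h2 ?_⟩, lt_of_le_of_ne h3 ?_,
    lt_of_le_of_ne h4 ?_⟩, rfl⟩ <;> intro h
  · refine c3.ne ?_
    simp [cross, map, F, ← h]; ring
  · refine c1.ne ?_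
    simp [cross, map, F, h]; ring
  · refine c0.ne ?_
    simp [cross, map, F, ← h]; ring
  · refine c2.ne ?_
    simp [cross, map, F, h]; ring

lemma volume_carrier_diff_cell (K : Quad) : volume (K.carrier \ K.cell) = 0 := by
  refine measure_mono_null ?_ (K.convex_carrier.addHaar_frontier volume)
  intro P hP
  exact ⟨subset_closure hP.1, fun h => hP.2 (K.interior_carrier_subset_cell h)⟩

end Quad

namespace QuadMesh

/-! ### Decomposition of integrals into elements -/

variable {Ω : Set Plane}

/-- In a conforming mesh two elements meet inside a line, so their open elements are disjoint. -/
lemma disjoint_cell (T : QuadMesh Ω) {K L : Quad} (hK : K ∈ T.elems) (hL : L ∈ T.elems)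
    (hKL : K ≠ L) : Disjoint K.cell L.cell := by
  have hsub : K.cell ∩ L.cell ⊆ K.carrier ∩ L.carrier :=
    Set.inter_subset_inter K.cell_subset_carrier L.cell_subset_carrier
  rw [Set.disjoint_iff_inter_eq_empty]
  have key : ∀ i, K.carrier ∩ L.carrier ⊆ {P | cross (K.z i) (K.z (i + 1)) P = 0} →
      K.cell ∩ L.cell = ∅ := by
    intro i hi
    refine Set.eq_empty_of_forall_notMem fun P hP => ?_
    exact (cross_pos_of_isOpen (K.z_ne_z_succ i) (K.isOpen_cell.inter L.isOpen_cell)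
      (fun Q hQ => (hi (hsub hQ)).ge) hP).ne' (hi (hsub hP))
  rcases T.conforming K hK L hL hKL with h | ⟨i, j, -, h⟩ | ⟨i, j, -, -, h⟩
  · exact Set.subset_empty_iff.mp (hsub.trans h.subset)
  · refine key i (h.subset.trans ?_)
    rintro _ rfl
    exact cross_self_left _ _
  · refine key i (h.subset.trans ?_)
    rintro _ ⟨a, b, _, _, hab, rfl⟩
    simp [cross_combo _ _ _ _ _ _ hab, cross_self_left, cross_self_right]

lemma cell_subset (hΩ : IsConvexPolygonalDomain Ω) (T : QuadMesh Ω) {K : Quad}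
    (hK : K ∈ T.elems) : K.cell ⊆ Ω := by
  obtain ⟨hne, s, rfl⟩ := hΩ
  have h1 : K.cell ⊆ closure (interior (convexHull ℝ (s : Set Plane))) := by
    rw [T.cover]
    exact K.cell_subset_carrier.trans (Set.subset_biUnion_of_mem (u := Quad.carrier) hK)
  have h2 := interior_maximal h1 K.isOpen_cell
  rwa [(convex_convexHull ℝ _).interior.interior_closure_eq_interior_of_nonempty_interior
    (by rwa [interior_interior]), interior_interior] at h2

/-- The open elements exhaust `Ω` up to a null set. -/
lemma ae_eq_iUnion_cell (hΩ : IsConvexPolygonalDomain Ω) (T : QuadMesh Ω) :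
    Ω =ᵐ[volume] ⋃ K ∈ T.elems, K.cell := by
  have hsub : (⋃ K ∈ T.elems, K.cell) ⊆ Ω :=
    Set.iUnion₂_subset fun K hK => T.cell_subset hΩ hK
  refine Filter.EventuallyLE.antisymm (ae_le_set.mpr ?_) hsub.eventuallyLE
  have : Ω \ ⋃ K ∈ T.elems, K.cell ⊆ ⋃ K ∈ T.elems, (K.carrier \ K.cell) := by
    rintro P ⟨hP, hn⟩
    have := subset_closure hP
    rw [T.cover] at this
    simp only [Set.mem_iUnion, exists_prop, not_exists, not_and] at this hn ⊢
    obtain ⟨K, hK, h⟩ := this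
    exact ⟨K, hK, h, hn K hK⟩
  refine measure_mono_null this ?_
  exact (measure_biUnion_null_iff T.elems.countable_toSet).mpr fun K _ => K.volume_carrier_diff_cell

lemma setIntegral_eq_sum_cell (hΩ : IsConvexPolygonalDomain Ω) (T : QuadMesh Ω) {f : Plane → ℝ}
    (hf : IntegrableOn f Ω) : ∫ x in Ω, f x = ∑ K ∈ T.elems, ∫ x in K.cell, f x := by
  rw [setIntegral_congr_set (T.ae_eq_iUnion_cell hΩ)]
  exact integral_biUnion_finset _ (fun K _ => K.isOpen_cell.measurableSet)
    (fun K hK L hL h => T.disjoint_cell hK hL h)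
    fun K hK => hf.mono_set (T.cell_subset hΩ hK)

end QuadMesh

/-! ### The local estimate -/

/-- Trace estimate for the coefficient of one reference coordinate in an ECQ4 stress mode: `x`, `y`,
`z` are its `11`, `22`, `12` entries and `(p, q)` is a column of the Jacobian matrix at the centre.
The multiples of the rank-one tensor `(p, q) ⊗ (p, q)` satisfy `q² x = p² y` and `q z = p y`, and
their trace is controlled by their deviator. The defects in these two equations are of the order
of the distortion `a`, `b`. -/
lemma sq_trace_le {p q x y z a b β₁ β₂ β₃ ε : ℝ} (hv : 0 < p ^ 2 + q ^ 2)
    (hab : a ^ 2 + b ^ 2 ≤ ε * (p ^ 2 + q ^ 2))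
    (h1 : q ^ 2 * x - p ^ 2 * y = -b * q * β₁ + a * p * β₂ + (a * q - p * b) * β₃)
    (h2 : q * z - p * y = a * β₂ - b * β₃) :
    (x + y) ^ 2 ≤ 2 * ((x - y) ^ 2 + (2 * z) ^ 2) +
      16 * ε * (β₁ ^ 2 + β₂ ^ 2 + β₃ ^ 2) := by
  set N := p ^ 2 + q ^ 2 with hN
  set B := β₁ ^ 2 + β₂ ^ 2 + β₃ ^ 2 with hB
  set R := -b * q * β₁ - a * p * β₂ + (a * q + p * b) * β₃ with hR
  have e : N * (x + y) = (p ^ 2 - q ^ 2) * (x - y) + 2 * p * q * (2 * z) + 2 * R := by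
    rw [hN, hR]
    linear_combination 2 * h1 - 4 * p * h2
  have hdev : ((p ^ 2 - q ^ 2) * (x - y) + 2 * p * q * (2 * z)) ^ 2 ≤
      N ^ 2 * ((x - y) ^ 2 + (2 * z) ^ 2) := by
    have := sq_nonneg ((p ^ 2 - q ^ 2) * (2 * z) - 2 * p * q * (x - y))
    rw [hN]
    linarith
  have hR1 : R ^ 2 ≤ (b ^ 2 * q ^ 2 + a ^ 2 * p ^ 2 + (a * q + p * b) ^ 2) * B := by
    rw [hR, hB]
    have s1 := sq_nonneg (-b * q * β₂ + a * p * β₁)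
    have s2 := sq_nonneg (-b * q * β₃ - (a * q + p * b) * β₁)
    have s3 := sq_nonneg (-a * p * β₃ - (a * q + p * b) * β₂)
    linarith
  have hB0 : 0 ≤ B := by positivity
  have hR2 : b ^ 2 * q ^ 2 + a ^ 2 * p ^ 2 + (a * q + p * b) ^ 2 ≤ 2 * ε * N ^ 2 := by
    have s1 := sq_nonneg (a * p - b * q)
    have s2 := mul_le_mul_of_nonneg_right hab hv.le
    have s3 : 0 ≤ (a * q) ^ 2 := by positivity
    have s4 : 0 ≤ (b * p) ^ 2 := by positivity
    rw [hN] at s2 ⊢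
    linarith
  have hR3 : R ^ 2 ≤ 2 * ε * N ^ 2 * B := hR1.trans (by gcongr)
  have hfin : N ^ 2 * (x + y) ^ 2 ≤
      N ^ 2 * (2 * ((x - y) ^ 2 + (2 * z) ^ 2) + 16 * ε * B) := by
    have s := sq_nonneg ((p ^ 2 - q ^ 2) * (x - y) + 2 * p * q * (2 * z) - 2 * R)
    rw [← mul_pow, e]
    linarith
  exact le_of_mul_le_mul_left hfin (by positivity)

/-- The deviatoric components `τ₁₁ - τ₂₂` and `2 τ₁₂`, as one squared length. For symmetric `τ` it is
twice the squared norm of the deviator. -/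
def devSq (τ : Matrix (Fin 2) (Fin 2) ℝ) : ℝ := (τ 0 0 - τ 1 1) ^ 2 + (2 * τ 0 1) ^ 2

namespace Quad

/-- The `ξ`-coefficients of an ECQ4 stress mode. -/
lemma sq_trace_le_of_xi (K : Quad) {ε : ℝ} (β : Fin 5 → ℝ)
    (h : K.a₁₂ ^ 2 + K.b₁₂ ^ 2 ≤ ε * (K.a₂ ^ 2 + K.b₂ ^ 2)) {x y z : ℝ}
    (hx : x = -(K.b₁₂ / K.b₂) * β 0 + K.a₁₂ * K.a₂ / K.b₂ ^ 2 * β 1 +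
      (K.a₁₂ * K.b₂ - K.a₂ * K.b₁₂) / K.b₂ ^ 2 * β 2 + K.a₂ ^ 2 / K.b₂ ^ 2 * β 4)
    (hy : y = β 4)
    (hz : z = K.a₁₂ / K.b₂ * β 1 - K.b₁₂ / K.b₂ * β 2 + K.a₂ / K.b₂ * β 4) :
    (x + y) ^ 2 ≤ 2 * ((x - y) ^ 2 + (2 * z) ^ 2) +
      16 * ε * (β 0 ^ 2 + β 1 ^ 2 + β 2 ^ 2) := by
  have hb : 0 < K.b₂ := K.b₂_pos
  refine sq_trace_le (p := K.a₂) (q := K.b₂) (a := K.a₁₂) (b := K.b₁₂) (by positivity) h ?_ ?_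
  · rw [hx, hy]; field_simp; ring
  · rw [hz, hy]; field_simp; ring

/-- The `η`-coefficients of an ECQ4 stress mode: the two coordinates exchange their roles. -/
lemma sq_trace_le_of_eta (K : Quad) {ε : ℝ} (β : Fin 5 → ℝ)
    (h : K.a₁₂ ^ 2 + K.b₁₂ ^ 2 ≤ ε * (K.a₁ ^ 2 + K.b₁ ^ 2)) {x y z : ℝ}
    (hx : x = β 3)
    (hy : y = K.b₁ * K.b₁₂ / K.a₁ ^ 2 * β 0 - K.a₁₂ / K.a₁ * β 1 +
      (K.a₁ * K.b₁₂ - K.a₁₂ * K.b₁) / K.a₁ ^ 2 * β 2 + K.b₁ ^ 2 / K.a₁ ^ 2 * β 3)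
    (hz : z = K.b₁₂ / K.a₁ * β 0 - K.a₁₂ / K.a₁ * β 2 + K.b₁ / K.a₁ * β 3) :
    (x + y) ^ 2 ≤ 2 * ((x - y) ^ 2 + (2 * z) ^ 2) +
      16 * ε * (β 0 ^ 2 + β 1 ^ 2 + β 2 ^ 2) := by
  have ha : 0 < K.a₁ := K.a₁_pos
  have := sq_trace_le (x := y) (y := x) (z := z) (p := K.b₁) (q := K.a₁) (a := K.b₁₂)
    (b := K.a₁₂) (β₁ := β 1) (β₂ := β 0) (β₃ := β 2) (ε := ε) (by positivity) (by linarith)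
    (by rw [hx, hy]; field_simp; ring) (by rw [hx, hz]; field_simp; ring)
  linarith

section Affine

variable {K : Quad} {f : Plane → ℝ} {p₀ p₁ p₂ : ℝ}

lemma setIntegral_cell_sq_eq (hf : ∀ p ∈ refSquare, f (K.map p) = p₀ + p₁ * p 0 + p₂ * p 1) :
    ∫ x in K.cell, f x ^ 2 =
      ∫ p in refSquare, K.jac (p 0) (p 1) * (p₀ + p₁ * p 0 + p₂ * p 1) ^ 2 := by
  rw [setIntegral_cell K fun x => f x ^ 2]
  exact setIntegral_congr_fun isOpen_refSquare.measurableSet fun p hp => by simp only [hf p hp]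

lemma continuous_jac_mul_affine_sq (K : Quad) (p₀ p₁ p₂ : ℝ) :
    Continuous fun p : Plane => K.jac (p 0) (p 1) * (p₀ + p₁ * p 0 + p₂ * p 1) ^ 2 := by
  unfold jac
  fun_prop

lemma setIntegral_cell_sq_le (hf : ∀ p ∈ refSquare, f (K.map p) = p₀ + p₁ * p 0 + p₂ * p 1) :
    ∫ x in K.cell, f x ^ 2 ≤ K.diam ^ 2 / 4 * (4 * p₀ ^ 2 + 4 / 3 * (p₁ ^ 2 + p₂ ^ 2)) := by
  rw [setIntegral_cell_sq_eq hf, ← setIntegral_refSquare_affine_sq, ← integral_const_mul]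
  refine setIntegral_mono_on (integrableOn_refSquare (K.continuous_jac_mul_affine_sq _ _ _))
    (integrableOn_refSquare (by fun_prop)) isOpen_refSquare.measurableSet fun p hp => ?_
  have := jac_le (K := K) (Set.Ioo_subset_Icc_self hp.1) (Set.Ioo_subset_Icc_self hp.2)
  gcongr

lemma le_setIntegral_cell_sq {ϱ : ℝ} (hϱ : 0 < ϱ) (h : K.diam ≤ ϱ * K.rho)
    (hf : ∀ p ∈ refSquare, f (K.map p) = p₀ + p₁ * p 0 + p₂ * p 1) :
    K.diam ^ 2 / (16 * ϱ ^ 2) * (4 * p₀ ^ 2 + 4 / 3 * (p₁ ^ 2 + p₂ ^ 2)) ≤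
      ∫ x in K.cell, f x ^ 2 := by
  rw [setIntegral_cell_sq_eq hf, ← setIntegral_refSquare_affine_sq, ← integral_const_mul]
  refine setIntegral_mono_on (integrableOn_refSquare (by fun_prop))
    (integrableOn_refSquare (K.continuous_jac_mul_affine_sq _ _ _))
    isOpen_refSquare.measurableSet fun p hp => ?_
  have := le_jac_of_shapeRegular hϱ h (Set.Ioo_subset_Icc_self hp.1)
    (Set.Ioo_subset_Icc_self hp.2)
  gcongr

end Affine

end Quad

/-- The mean value minimizes the distance to the constants in `L²`. -/
lemma setIntegral_sub_average_sq_le {s : Set Plane} {f : Plane → ℝ} (hs : volume s ≠ ⊤)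
    (hf : MemLp f 2 (volume.restrict s)) (c : ℝ) :
    ∫ x in s, (f x - ⨍ y in s, f y) ^ 2 ≤ ∫ x in s, (f x - c) ^ 2 := by
  have : IsFiniteMeasure (volume.restrict s) := isFiniteMeasure_restrict.mpr hs
  set m := ⨍ y in s, f y with hm
  have h1 : MemLp (fun x => f x - m) 2 (volume.restrict s) := hf.sub (memLp_const m)
  have h0 : ∫ x in s, (f x - m) = 0 := integral_sub_average _ f
  have e : ∀ x, (f x - c) ^ 2 = (f x - m) ^ 2 + (2 * (m - c) * (f x - m) + (m - c) ^ 2) :=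
    fun x => by ring
  have hi : Integrable (fun x => f x - m) (volume.restrict s) := h1.integrable (by norm_num)
  simp only [e]
  have hi' : Integrable (fun x => 2 * (m - c) * (f x - m)) (volume.restrict s) := hi.const_mul _
  have hi'' : Integrable (fun x => 2 * (m - c) * (f x - m) + (m - c) ^ 2) (volume.restrict s) :=
    hi'.add (integrable_const _)
  rw [integral_add h1.integrable_sq hi'', integral_add hi' (integrable_const _),
    integral_const_mul, h0]
  have : 0 ≤ ∫ x in s, (m - c) ^ 2 := integral_nonneg fun _ => sq_nonneg _
  linarith

namespace Quad

/-- On a slightly distorted element the oscillation of the trace of an ECQ4 stress is controlled by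
its deviator, up to a small multiple of the trace itself. -/
lemma setIntegral_cell_trace_sub_average_le {K : Quad} {ϱ ε : ℝ} (hϱ : 0 < ϱ)
    (h : K.diam ≤ ϱ * K.rho) (hε : 0 ≤ ε) (hε1 : ε ≤ 1)
    (h₁ : K.a₁₂ ^ 2 + K.b₁₂ ^ 2 ≤ ε * (K.a₁ ^ 2 + K.b₁ ^ 2))
    (h₂ : K.a₁₂ ^ 2 + K.b₁₂ ^ 2 ≤ ε * (K.a₂ ^ 2 + K.b₂ ^ 2))
    {τ : Plane → Matrix (Fin 2) (Fin 2) ℝ}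
    (hτ : ∀ i j, MemLp (fun x => τ x i j) 2 (volume.restrict K.cell))
    {β : Fin 5 → ℝ} (hmode : ∀ ξ ∈ Set.Ioo (-1 : ℝ) 1, ∀ η ∈ Set.Ioo (-1 : ℝ) 1,
      ![τ (K.F ξ η) 0 0, τ (K.F ξ η) 1 1, τ (K.F ξ η) 0 1] = (K.ecMode ξ η).mulVec β) :
    ∫ x in K.cell, ((τ x).trace - ⨍ y in K.cell, (τ y).trace) ^ 2 ≤
      64 * ϱ ^ 2 * ((∫ x in K.cell, devSq (τ x)) + ε * ∫ x in K.cell, (τ x).trace ^ 2) := by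
  obtain ⟨x, hx⟩ : ∃ x, x = -(K.b₁₂ / K.b₂) * β 0 + K.a₁₂ * K.a₂ / K.b₂ ^ 2 * β 1 +
      (K.a₁₂ * K.b₂ - K.a₂ * K.b₁₂) / K.b₂ ^ 2 * β 2 + K.a₂ ^ 2 / K.b₂ ^ 2 * β 4 := ⟨_, rfl⟩
  obtain ⟨z, hz⟩ : ∃ z, z = K.a₁₂ / K.b₂ * β 1 - K.b₁₂ / K.b₂ * β 2 + K.a₂ / K.b₂ * β 4 :=
    ⟨_, rfl⟩
  obtain ⟨y', hy'⟩ : ∃ y', y' = K.b₁ * K.b₁₂ / K.a₁ ^ 2 * β 0 - K.a₁₂ / K.a₁ * β 1 +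
      (K.a₁ * K.b₁₂ - K.a₁₂ * K.b₁) / K.a₁ ^ 2 * β 2 + K.b₁ ^ 2 / K.a₁ ^ 2 * β 3 := ⟨_, rfl⟩
  obtain ⟨z', hz'⟩ : ∃ z', z' = K.b₁₂ / K.a₁ * β 0 - K.a₁₂ / K.a₁ * β 2 + K.b₁ / K.a₁ * β 3 :=
    ⟨_, rfl⟩
  have hξ := K.sq_trace_le_of_xi β h₂ hx rfl hz
  have hη := K.sq_trace_le_of_eta β h₁ rfl hy' hz'
  have hval : ∀ p ∈ refSquare, τ (K.map p) 0 0 = β 0 + x * p 0 + β 3 * p 1 ∧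
      τ (K.map p) 1 1 = β 1 + β 4 * p 0 + y' * p 1 ∧
      τ (K.map p) 0 1 = β 2 + z * p 0 + z' * p 1 := by
    intro p hp
    have e := hmode (p 0) hp.1 (p 1) hp.2
    have e0 := congrFun e 0
    have e1 := congrFun e 1
    have e2 := congrFun e 2
    simp [ecMode, Matrix.mulVec, dotProduct, Fin.sum_univ_five] at e0 e1 e2
    simp only [map, e0, e1, e2, hx, hz, hy', hz']
    refine ⟨by ring, by ring, by ring⟩
  have hQ : ∀ p ∈ refSquare, (τ (K.map p)).trace =
      (β 0 + β 1) + (x + β 4) * p 0 + (β 3 + y') * p 1 := by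
    intro p hp
    obtain ⟨e0, e1, -⟩ := hval p hp
    rw [Matrix.trace_fin_two, e0, e1]; ring
  have hQ' : ∀ p ∈ refSquare, (τ (K.map p)).trace - (β 0 + β 1) =
      0 + (x + β 4) * p 0 + (β 3 + y') * p 1 := by
    intro p hp
    rw [hQ p hp]; ring
  have hD₁ : ∀ p ∈ refSquare, τ (K.map p) 0 0 - τ (K.map p) 1 1 =
      (β 0 - β 1) + (x - β 4) * p 0 + (β 3 - y') * p 1 := by
    intro p hp
    obtain ⟨e0, e1, -⟩ := hval p hp
    rw [e0, e1]; ring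
  have hD₂ : ∀ p ∈ refSquare, 2 * τ (K.map p) 0 1 =
      2 * β 2 + 2 * z * p 0 + 2 * z' * p 1 := by
    intro p hp
    rw [(hval p hp).2.2]; ring
  have htr : MemLp (fun x => (τ x).trace) 2 (volume.restrict K.cell) := by
    simp only [Matrix.trace_fin_two]
    exact (hτ 0 0).add (hτ 1 1)
  have hdev : ∫ x in K.cell, devSq (τ x) =
      (∫ x in K.cell, (τ x 0 0 - τ x 1 1) ^ 2) + ∫ x in K.cell, (2 * τ x 0 1) ^ 2 :=
    integral_add ((hτ 0 0).sub (hτ 1 1)).integrable_sq ((hτ 0 1).const_mul 2).integrable_sq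
  have i₀ := setIntegral_cell_sq_le (f := fun x => (τ x).trace - (β 0 + β 1)) hQ'
  have i₁ := le_setIntegral_cell_sq (f := fun x => (τ x).trace) hϱ h hQ
  have i₂ := le_setIntegral_cell_sq (f := fun x => τ x 0 0 - τ x 1 1) hϱ h hD₁
  have i₃ := le_setIntegral_cell_sq (f := fun x => 2 * τ x 0 1) hϱ h hD₂
  refine (setIntegral_sub_average_sq_le K.volume_cell_ne_top htr (β 0 + β 1)).trans (i₀.trans ?_)
  rw [hdev]
  set H := K.diam ^ 2 / (16 * ϱ ^ 2) with hH
  have hHpos : 0 ≤ H := by positivity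
  have e : K.diam ^ 2 / 4 = 4 * ϱ ^ 2 * H := by rw [hH]; field_simp; norm_num
  -- The estimate for the coefficients on the reference square.
  have hcoef : 4 * 0 ^ 2 + 4 / 3 * ((x + β 4) ^ 2 + (β 3 + y') ^ 2) ≤
      16 * ((4 * (β 0 - β 1) ^ 2 + 4 / 3 * ((x - β 4) ^ 2 + (β 3 - y') ^ 2)) +
        (4 * (2 * β 2) ^ 2 + 4 / 3 * ((2 * z) ^ 2 + (2 * z') ^ 2)) +
        ε * (4 * (β 0 + β 1) ^ 2 + 4 / 3 * ((x + β 4) ^ 2 + (β 3 + y') ^ 2))) := by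
    have j₀ : 0 ≤ ε * ((x + β 4) ^ 2 + (β 3 + y') ^ 2) := by positivity
    have j₁ : ε * (β 0 - β 1) ^ 2 ≤ (β 0 - β 1) ^ 2 :=
      mul_le_of_le_one_left (sq_nonneg _) hε1
    have j₂ : ε * (2 * β 2) ^ 2 ≤ (2 * β 2) ^ 2 := mul_le_of_le_one_left (sq_nonneg _) hε1
    have j₃ : 0 ≤ ε * (β 0 + β 1) ^ 2 := by positivity
    have j₄ : 0 ≤ (x - β 4) ^ 2 := sq_nonneg _
    have j₅ : 0 ≤ (β 3 - y') ^ 2 := sq_nonneg _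
    have j₆ : 0 ≤ (2 * z) ^ 2 := sq_nonneg _
    have j₇ : 0 ≤ (2 * z') ^ 2 := sq_nonneg _
    have j₈ : 0 ≤ (2 * β 2) ^ 2 := sq_nonneg _
    have j₉ : 0 ≤ (β 0 - β 1) ^ 2 := sq_nonneg _
    have e' : ε * (β 0 ^ 2 + β 1 ^ 2 + β 2 ^ 2) = 1 / 2 * (ε * (β 0 + β 1) ^ 2) +
        1 / 2 * (ε * (β 0 - β 1) ^ 2) + 1 / 4 * (ε * (2 * β 2) ^ 2) := by ring
    rw [mul_assoc, e'] at hξ hη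
    generalize (x + β 4) ^ 2 = s₁ at *
    generalize (β 3 + y') ^ 2 = s₂ at *
    generalize (x - β 4) ^ 2 = s₃ at *
    generalize (β 3 - y') ^ 2 = s₄ at *
    generalize (2 * z) ^ 2 = s₅ at *
    generalize (2 * z') ^ 2 = s₆ at *
    generalize (2 * β 2) ^ 2 = s₇ at *
    generalize (β 0 - β 1) ^ 2 = s₈ at *
    generalize (β 0 + β 1) ^ 2 = s₉ at *
    linarith
  rw [e]
  have hkey := mul_le_mul_of_nonneg_left hcoef (by positivity : (0 : ℝ) ≤ 4 * ϱ ^ 2 * H)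
  refine hkey.trans ?_
  have hi₁ := mul_le_mul_of_nonneg_left i₁ hε
  have hϱ2 : (0 : ℝ) ≤ 64 * ϱ ^ 2 := by positivity
  have := mul_le_mul_of_nonneg_left (add_le_add (add_le_add i₂ i₃) hi₁) hϱ2
  linarith

end Quad

lemma IsConvexPolygonalDomain.isOpen {Ω : Set Plane} (hΩ : IsConvexPolygonalDomain Ω) :
    IsOpen Ω := by
  obtain ⟨-, s, rfl⟩ := hΩ
  exact isOpen_interior

lemma IsConvexPolygonalDomain.isFiniteMeasure {Ω : Set Plane} (hΩ : IsConvexPolygonalDomain Ω) :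
    IsFiniteMeasure (volume.restrict Ω) := by
  obtain ⟨-, s, rfl⟩ := hΩ
  exact isFiniteMeasure_restrict.mpr
    (((s.finite_toSet.isCompact_convexHull (𝕜 := ℝ)).isBounded.subset
      interior_subset).measure_lt_top).ne

namespace QuadMesh

/-! ### Cell averages -/

variable {Ω : Set Plane}

/-- The `L²` projection onto piecewise constants: the mean value on each open element, and zero
off the open elements. -/
def cellAverage (T : QuadMesh Ω) (f : Plane → ℝ) (x : Plane) : ℝ :=
  ∑ K ∈ T.elems, K.cell.indicator (fun _ => ⨍ y in K.cell, f y) x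

lemma cellAverage_of_mem (T : QuadMesh Ω) (f : Plane → ℝ) {K : Quad} (hK : K ∈ T.elems)
    {x : Plane} (hx : x ∈ K.cell) : T.cellAverage f x = ⨍ y in K.cell, f y := by
  rw [cellAverage, Finset.sum_eq_single_of_mem K hK, Set.indicator_of_mem hx]
  intro L hL hLK
  exact Set.indicator_of_notMem (Set.disjoint_left.mp (T.disjoint_cell hK hL hLK.symm) hx) _

lemma memLp_cellAverage (hΩ : IsConvexPolygonalDomain Ω) (T : QuadMesh Ω) (f : Plane → ℝ) :
    MemLp (T.cellAverage f) 2 (volume.restrict Ω) := by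
  have := hΩ.isFiniteMeasure
  exact memLp_finsetSum _ fun K _ => (memLp_const _).indicator K.isOpen_cell.measurableSet

lemma setIntegral_cellAverage (hΩ : IsConvexPolygonalDomain Ω) (T : QuadMesh Ω)
    {f : Plane → ℝ} (hf : IntegrableOn f Ω) :
    ∫ x in Ω, T.cellAverage f x = ∫ x in Ω, f x := by
  have := hΩ.isFiniteMeasure
  rw [T.setIntegral_eq_sum_cell hΩ hf, T.setIntegral_eq_sum_cell hΩ
    ((T.memLp_cellAverage hΩ f).integrable (by norm_num))]
  refine Finset.sum_congr rfl fun K hK => ?_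
  rw [setIntegral_congr_fun K.isOpen_cell.measurableSet
    fun x hx => T.cellAverage_of_mem f hK hx]
  have : IsFiniteMeasure (volume.restrict K.cell) :=
    isFiniteMeasure_restrict.mpr K.volume_cell_ne_top
  exact integral_average (volume.restrict K.cell) f

lemma memWbar_cellAverage (hΩ : IsConvexPolygonalDomain Ω) {ΓN : Set Plane} (T : QuadMesh Ω)
    {f : Plane → ℝ} (hf : MemL Ω ΓN f) : MemWbar ΓN T (T.cellAverage f) := by
  have := hΩ.isFiniteMeasure
  refine ⟨⟨T.memLp_cellAverage hΩ f, fun h => ?_⟩, fun K hK => ⟨⨍ y in K.cell, f y, ?_⟩⟩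
  · rw [T.setIntegral_cellAverage hΩ (hf.memLp.integrable (by norm_num)), hf.mean_zero h]
  · intro ξ hξ η hη
    refine T.cellAverage_of_mem f hK ⟨pt ξ η, ?_, ?_⟩
    · simpa [refSquare, pt] using ⟨hξ, hη⟩
    · simp [Quad.map, pt]

end QuadMesh

/-! ### The kernel coercivity -/

variable {Ω : Set Plane}

lemma MemSigma.memLp_trace {ΓN : Set Plane} {τ : Plane → Matrix (Fin 2) (Fin 2) ℝ}
    (h : MemSigma Ω ΓN τ) : MemLp (fun x => (τ x).trace) 2 (volume.restrict Ω) := by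
  simp only [Matrix.trace_fin_two]
  exact (h.memLp 0 0).add (h.memLp 1 1)

lemma MemSigma.integrable_devSq {ΓN : Set Plane} {τ : Plane → Matrix (Fin 2) (Fin 2) ℝ}
    (h : MemSigma Ω ΓN τ) : IntegrableOn (fun x => devSq (τ x)) Ω :=
  (((h.memLp 0 0).sub (h.memLp 1 1)).integrable_sq).add ((h.memLp 0 1).const_mul 2).integrable_sq

/-- The local estimates summed over a mesh. -/
lemma setIntegral_trace_sub_cellAverage_le (hΩ : IsConvexPolygonalDomain Ω) {ΓN : Set Plane}
    {T : QuadMesh Ω} {ϱ ε : ℝ} (hϱ : 0 < ϱ) (hε : 0 ≤ ε) (hε1 : ε ≤ 1)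
    (hshape : ∀ K ∈ T.elems, K.diam ≤ ϱ * K.rho)
    (hdist : ∀ K ∈ T.elems, K.diagDist ^ 2 ≤ ε / (32 * ϱ ^ 4) * K.diam ^ 2)
    {τ : Plane → Matrix (Fin 2) (Fin 2) ℝ} (hτ : MemSigmaEC ΓN T τ) :
    ∫ x in Ω, ((τ x).trace - T.cellAverage (fun y => (τ y).trace) x) ^ 2 ≤
      64 * ϱ ^ 2 * ((∫ x in Ω, devSq (τ x)) + ε * ∫ x in Ω, (τ x).trace ^ 2) := by
  have htr := hτ.memSigma.memLp_trace
  have hI : IntegrableOn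
      (fun x => ((τ x).trace - T.cellAverage (fun y => (τ y).trace) x) ^ 2) Ω :=
    (htr.sub (T.memLp_cellAverage hΩ _)).integrable_sq
  rw [T.setIntegral_eq_sum_cell hΩ hτ.memSigma.integrable_devSq,
    T.setIntegral_eq_sum_cell hΩ htr.integrable_sq,
    T.setIntegral_eq_sum_cell hΩ hI,
    Finset.mul_sum, ← Finset.sum_add_distrib, Finset.mul_sum]
  refine Finset.sum_le_sum fun K hK => ?_
  rw [setIntegral_congr_fun K.isOpen_cell.measurableSet
    fun x hx => by rw [T.cellAverage_of_mem _ hK hx]]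
  obtain ⟨β, hβ⟩ := hτ.mode K hK
  have hd := hdist K hK
  rw [K.diagDist_sq] at hd
  have hab : K.a₁₂ ^ 2 + K.b₁₂ ^ 2 ≤ ε * (K.diam ^ 2 / (128 * ϱ ^ 4)) := by
    have e : ε / (32 * ϱ ^ 4) * K.diam ^ 2 = 4 * (ε * (K.diam ^ 2 / (128 * ϱ ^ 4))) := by
      field_simp; ring
    linarith
  obtain ⟨hc₁, hc₂⟩ := Quad.le_sq_columns hϱ (hshape K hK)
  exact Quad.setIntegral_cell_trace_sub_average_le hϱ (hshape K hK) hε hε1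
    (hab.trans (by gcongr)) (hab.trans (by gcongr))
    (fun i j => (hτ.memSigma.memLp i j).mono_measure
      (Measure.restrict_mono (T.cell_subset hΩ hK) le_rfl)) hβ

/-- A pressure `q` tested against `div v` splits into its distance from the trace of `τ`, the
energy pairing, and a deviatoric part; each product is then estimated with weight `t`. -/
lemma mul_trace_le (A D : Matrix (Fin 2) (Fin 2) ℝ) (hA : A.IsSymm) (q : ℝ) {t : ℝ} (ht : 0 < t) :
    q * D.trace ≤ 2 * contract A (strain D) +
      (1 / (2 * t) * ((A.trace - q) ^ 2 + devSq A) + t * contract D D) := by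
  have hs : A 1 0 = A 0 1 := hA.apply 0 1
  have young : ∀ x y : ℝ, -(x * y) ≤ 1 / (2 * t) * x ^ 2 + t / 2 * y ^ 2 := by
    intro x y
    have e : 1 / (2 * t) * x ^ 2 + t / 2 * y ^ 2 + x * y = (x + t * y) ^ 2 / (2 * t) := by
      field_simp; ring
    have : 0 ≤ (x + t * y) ^ 2 / (2 * t) := by positivity
    linarith
  have y₁ := young (A 0 0 + A 1 1 - q) (D 0 0 + D 1 1)
  have y₂ := young (A 0 0 - A 1 1) (D 0 0 - D 1 1)
  have y₃ := young (2 * A 0 1) (D 0 1 + D 1 0)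
  have hpos : 0 ≤ t / 2 * (D 0 1 - D 1 0) ^ 2 := by positivity
  simp only [contract, strain, devSq, Matrix.trace_fin_two, Fin.sum_univ_two, Matrix.smul_apply,
    Matrix.add_apply, Matrix.transpose_apply, smul_eq_mul, hs]
  have hpos' : 0 ≤ t / 2 * (D 0 1) ^ 2 := by positivity
  have hpos'' : 0 ≤ t / 2 * (D 1 0) ^ 2 := by positivity
  linarith

lemma MemVh.memLp_jacobian {ΓD : Set Plane} {T : QuadMesh Ω} {v : Plane → Fin 2 → ℝ}
    {Dv : Plane → Matrix (Fin 2) (Fin 2) ℝ} (h : MemVh ΓD T v Dv) (i j : Fin 2) :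
    MemLp (fun x => Dv x i j) 2 (volume.restrict Ω) :=
  (h.memV i).memH1.memLp_grad j

lemma integrableOn_contract {A B : Plane → Matrix (Fin 2) (Fin 2) ℝ}
    (hA : ∀ i j, MemLp (fun x => A x i j) 2 (volume.restrict Ω))
    (hB : ∀ i j, MemLp (fun x => B x i j) 2 (volume.restrict Ω)) :
    IntegrableOn (fun x => contract (A x) (B x)) Ω :=
  integrable_finsetSum _ fun i _ => integrable_finsetSum _ fun j _ =>
    (hA i j).integrable_mul (hB i j)

/-- Stability of the Q1-P0 pair controls the cell averages of the trace of a discretely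
self-equilibrated stress. -/
lemma setIntegral_cellAverage_sq_le (hΩ : IsConvexPolygonalDomain Ω) {ΓD ΓN : Set Plane}
    {T : QuadMesh Ω} {C : ℝ} (hC : 0 < C)
    (hstab : ∀ q : Plane → ℝ, MemWbar ΓN T q → ∃ v Dv, MemVh ΓD T v Dv ∧
      ∫ x in Ω, q x ^ 2 ≤ C * ∫ x in Ω, q x * (Dv x).trace ∧
      normSq Ω Dv ≤ C * ∫ x in Ω, q x ^ 2)
    {τ : Plane → Matrix (Fin 2) (Fin 2) ℝ} (hτ : MemZh ΓD ΓN T τ) :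
    ∫ x in Ω, T.cellAverage (fun y => (τ y).trace) x ^ 2 ≤
      2 * C ^ 3 * ((∫ x in Ω, ((τ x).trace - T.cellAverage (fun y => (τ y).trace) x) ^ 2) +
        ∫ x in Ω, devSq (τ x)) := by
  have hσ := hτ.memSigmaEC.memSigma
  have htr := hσ.memLp_trace
  set q := T.cellAverage fun y => (τ y).trace with hq
  have hqL : MemLp q 2 (volume.restrict Ω) := T.memLp_cellAverage hΩ _
  obtain ⟨v, Dv, hv, h₁, h₂⟩ := hstab q (T.memWbar_cellAverage hΩ ⟨htr, hσ.mean_zero⟩)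
  have hDv := hv.memLp_jacobian
  have hdiv : MemLp (fun x => (Dv x).trace) 2 (volume.restrict Ω) := by
    simp only [Matrix.trace_fin_two]
    exact (hDv 0 0).add (hDv 1 1)
  have hstrain : ∀ i j, MemLp (fun x => strain (Dv x) i j) 2 (volume.restrict Ω) := fun i j =>
    ((hDv i j).add (hDv j i)).const_mul (1 / 2)
  -- This weight lets half of the left-hand side absorb the gradient term.
  set t : ℝ := 1 / (2 * C ^ 2) with ht
  have ht0 : 0 < t := by positivity
  have I₁ : IntegrableOn (fun x => 2 * contract (τ x) (strain (Dv x))) Ω :=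
    (integrableOn_contract hσ.memLp hstrain).const_mul 2
  have I₂ : IntegrableOn (fun x => ((τ x).trace - q x) ^ 2) Ω := (htr.sub hqL).integrable_sq
  have I₃ : IntegrableOn (fun x => ((τ x).trace - q x) ^ 2 + devSq (τ x)) Ω :=
    I₂.add hσ.integrable_devSq
  have I₄ : IntegrableOn (fun x => 1 / (2 * t) * (((τ x).trace - q x) ^ 2 + devSq (τ x))) Ω :=
    I₃.const_mul _
  have I₅ : IntegrableOn (fun x => t * contract (Dv x) (Dv x)) Ω :=
    (integrableOn_contract hDv hDv).const_mul t
  have I₆ : IntegrableOn (fun x => 1 / (2 * t) * (((τ x).trace - q x) ^ 2 + devSq (τ x)) +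
      t * contract (Dv x) (Dv x)) Ω := I₄.add I₅
  have hle : ∫ x in Ω, q x * (Dv x).trace ≤ ∫ x in Ω, (2 * contract (τ x) (strain (Dv x)) +
      (1 / (2 * t) * (((τ x).trace - q x) ^ 2 + devSq (τ x)) + t * contract (Dv x) (Dv x))) :=
    setIntegral_mono_on (hqL.integrable_mul hdiv) (I₁.add I₆) hΩ.isOpen.measurableSet
      fun x hx => mul_trace_le _ _ (hσ.symm x hx) _ ht0
  rw [integral_add I₁ I₆, integral_const_mul, hτ.orth v Dv hv, integral_add I₄ I₅,
    integral_const_mul, integral_add I₂ hσ.integrable_devSq, integral_const_mul] at hle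
  change _ ≤ _ + (_ + t * normSq Ω Dv) at hle
  set S := ∫ x in Ω, q x ^ 2
  set X := ∫ x in Ω, ((τ x).trace - q x) ^ 2
  set Y := ∫ x in Ω, devSq (τ x)
  have e₁ : 1 / (2 * t) = C ^ 2 := by rw [ht]; field_simp
  have e₂ : C * (t * (C * S)) = S / 2 := by rw [ht]; field_simp
  rw [e₁] at hle
  have h₃ := mul_le_mul_of_nonneg_left hle hC.le
  have h₄ : C * (t * normSq Ω Dv) ≤ C * (t * (C * S)) := by gcongr
  linarith

/-- The energy density is `|dev τ|² / (2 μ)` plus a nonnegative multiple of `(tr τ)²`, which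
vanishes as `lam → ∞`; hence only the first term is kept. -/
lemma contract_compliance_ge {A : Matrix (Fin 2) (Fin 2) ℝ} (hA : A.IsSymm) {μ lam μ₁ : ℝ}
    (hμ : 0 < μ) (hμ₁ : μ ≤ μ₁) (hlam : 0 < lam) :
    1 / (4 * μ₁) * devSq A ≤ contract A (compliance μ lam A) := by
  have hs : A 1 0 = A 0 1 := hA.apply 0 1
  have e : contract A (compliance μ lam A) =
      1 / (4 * μ) * devSq A + 1 / (4 * (μ + lam)) * A.trace ^ 2 := by
    simp [contract, compliance, devSq, Matrix.trace_fin_two, hs]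
    field_simp
    ring
  have hd : 0 ≤ devSq A := by unfold devSq; positivity
  have h1 : 1 / (4 * μ₁) * devSq A ≤ 1 / (4 * μ) * devSq A := by gcongr
  have h2 : 0 ≤ 1 / (4 * (μ + lam)) * A.trace ^ 2 := by positivity
  linarith

lemma contract_self_eq {A : Matrix (Fin 2) (Fin 2) ℝ} (hA : A.IsSymm) :
    contract A A = 1 / 2 * A.trace ^ 2 + 1 / 2 * devSq A := by
  have hs : A 1 0 = A 0 1 := hA.apply 0 1
  simp [contract, devSq, Matrix.trace_fin_two, hs]
  ring

/-- A bound of the trace by the deviator turns into coercivity, uniformly in `lam`. -/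
lemma normSq_le_aForm (hΩ : IsConvexPolygonalDomain Ω) {ΓN : Set Plane}
    {τ : Plane → Matrix (Fin 2) (Fin 2) ℝ} (hσ : MemSigma Ω ΓN τ) {B μ lam μ₁ : ℝ} (hB : 0 ≤ B)
    (hμ : 0 < μ) (hμ₁ : μ ≤ μ₁) (hlam : 0 < lam)
    (h : ∫ x in Ω, (τ x).trace ^ 2 ≤ B * ∫ x in Ω, devSq (τ x)) :
    normSq Ω τ ≤ 2 * μ₁ * (B + 1) * aForm Ω μ lam τ τ := by
  have hI := hσ.integrable_devSq
  have htr := hσ.memLp_trace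
  have hcomp : ∀ i j, MemLp (fun x => compliance μ lam (τ x) i j) 2 (volume.restrict Ω) :=
    fun i j => ((hσ.memLp i j).sub ((htr.const_mul (lam / (2 * (μ + lam)))).mul_const
      ((1 : Matrix (Fin 2) (Fin 2) ℝ) i j))).const_mul (1 / (2 * μ))
  have h1 : normSq Ω τ = 1 / 2 * (∫ x in Ω, (τ x).trace ^ 2) + 1 / 2 * ∫ x in Ω, devSq (τ x) := by
    rw [normSq, setIntegral_congr_fun hΩ.isOpen.measurableSet
      fun x hx => contract_self_eq (hσ.symm x hx), integral_add (htr.integrable_sq.const_mul _)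
      (hI.const_mul _), integral_const_mul, integral_const_mul]
  have h2 : 1 / (4 * μ₁) * ∫ x in Ω, devSq (τ x) ≤ aForm Ω μ lam τ τ := by
    rw [← integral_const_mul]
    exact setIntegral_mono_on (hI.const_mul _) (integrableOn_contract hσ.memLp hcomp)
      hΩ.isOpen.measurableSet fun x hx => contract_compliance_ge (hσ.symm x hx) hμ hμ₁ hlam
  have hμ₁0 : 0 < μ₁ := hμ.trans_le hμ₁
  have h3 := mul_le_mul_of_nonneg_left h2 (by positivity : 0 ≤ 2 * μ₁ * (B + 1))
  have e : 2 * μ₁ * (B + 1) * (1 / (4 * μ₁) * ∫ x in Ω, devSq (τ x)) =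
      1 / 2 * (B + 1) * ∫ x in Ω, devSq (τ x) := by field_simp; norm_num
  linarith

end ECQ4

end

theorem theorem4p4 (Ω ΓD ΓN : Set Plane) (hΩ : IsConvexPolygonalDomain Ω)
    (hΓ : frontier Ω = ΓD ∪ ΓN) (hΓD_meas : MeasurableSet ΓD) (hΓN_meas : MeasurableSet ΓN)
    (hΓD : 0 < MeasureTheory.Measure.hausdorffMeasure 1 ΓD)
    (hΓN : ΓN = ∅ ∨ 0 < MeasureTheory.Measure.hausdorffMeasure 1 ΓN)
    {ι : Type*} (T : ι → QuadMesh Ω)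
    (hshape : ShapeRegular T) (hstab : Q1P0Stable ΓD ΓN T) (hA : ConditionA T) :
    ∃ h₀ : ℝ, 0 < h₀ ∧ ∀ μ₁ : ℝ, 0 < μ₁ → ∃ C : ℝ, 0 < C ∧
      ∀ μ lam : ℝ, 0 < μ → μ ≤ μ₁ → 0 < lam → ∀ i, (T i).size < h₀ →
        ∀ τ, MemZh ΓD ΓN (T i) τ → normSq Ω τ ≤ C * aForm Ω μ lam τ τ := by
  obtain ⟨ϱ, hϱ2, hreg⟩ := hshape
  obtain ⟨C₀, hC₀, hst⟩ := hstab
  have hϱ : 0 < ϱ := by linarith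
  set M : ℝ := 4 * C₀ ^ 3 + 2 with hM
  have hM2 : 2 ≤ M := by
    have : 0 < C₀ ^ 3 := by positivity
    linarith
  -- With this `ε` the trace term `64 ϱ² ε M ∫ (tr τ)²` is half of what it is compared with.
  set ε : ℝ := 1 / (128 * M * ϱ ^ 2) with hεdef
  have hε : 0 < ε := by positivity
  have hε1 : ε ≤ 1 := by
    rw [hεdef, div_le_one (by positivity)]
    nlinarith
  obtain ⟨h₀, hh₀, hdist⟩ := hA (√(ε / (32 * ϱ ^ 4))) (by positivity)
  refine ⟨h₀, hh₀, fun μ₁ hμ₁ => ⟨2 * μ₁ * (2 * M * (1 + 64 * ϱ ^ 2) + 1), by positivity, ?_⟩⟩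
  intro μ lam hμ hμle hlam i hi τ hτ
  refine normSq_le_aForm hΩ hτ.memSigmaEC.memSigma (by positivity) hμ hμle hlam ?_
  have hosc := setIntegral_trace_sub_cellAverage_le hΩ hϱ hε.le hε1 (hreg i) (fun K hK => by
    have := pow_le_pow_left₀ dist_nonneg (hdist i hi K hK) 2
    rwa [mul_pow, Real.sq_sqrt (by positivity)] at this) hτ.memSigmaEC
  have havg := setIntegral_cellAverage_sq_le hΩ hC₀ (hst i) hτ
  have htr := hτ.memSigmaEC.memSigma.memLp_trace
  set q := (T i).cellAverage fun y => (τ y).trace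
  have hqL : MemLp q 2 (volume.restrict Ω) := (T i).memLp_cellAverage hΩ _
  have I₁ : IntegrableOn (fun x => 2 * q x ^ 2) Ω := hqL.integrable_sq.const_mul 2
  have I₂ : IntegrableOn (fun x => 2 * ((τ x).trace - q x) ^ 2) Ω :=
    (htr.sub hqL).integrable_sq.const_mul 2
  have hsplit : ∫ x in Ω, (τ x).trace ^ 2 ≤
      2 * (∫ x in Ω, q x ^ 2) + 2 * ∫ x in Ω, ((τ x).trace - q x) ^ 2 := by
    rw [← integral_const_mul, ← integral_const_mul, ← integral_add I₁ I₂]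
    refine integral_mono htr.integrable_sq (I₁.add I₂) fun x => ?_
    have := sq_nonneg ((τ x).trace - 2 * q x)
    simp only
    linarith
  set Y := ∫ x in Ω, devSq (τ x)
  set X := ∫ x in Ω, ((τ x).trace - q x) ^ 2
  set R := ∫ x in Ω, (τ x).trace ^ 2
  have hY : 0 ≤ Y := integral_nonneg fun x => by
    simp only [devSq, Pi.zero_apply]; positivity
  have h₁ : R ≤ M * (X + Y) := by linarith
  have h₂ : M * (X + Y) ≤ M * (64 * ϱ ^ 2 * (Y + ε * R) + Y) := by gcongr
  have h₃ : M * (64 * ϱ ^ 2 * (ε * R)) = R / 2 := by rw [hεdef]; field_simp; ring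
  linarith
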